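/- **Theorem 4.** A *lattice* is a free abelian group $\Lambda$ of finite rank with an integral positive definite symmetric bilinear form $(\cdot,\cdot)$. For an even unimodular lattice $\Lambda$ of rank $24$ let $$\vartheta_\Lambda(Z)=\sum_{g\in\Lambda^{12}}\exp\bigl(\pi i\,\mathrm{tr}(T(g)Z)\bigr),\qquad T(g)=\bigl((g_i,g_j)\bigr)_{1\le i,j\le 12},$$ be its theta series of degree $12$, a function on the Siegel upper half space $\mathbb H_{12}$ of symmetric complex $12\times12$ matrices with positive definite imaginary part. The *root lattice* of $\Lambda$ is the sublattice generated by the vectors of norm $(x,x)=2$. For each of the $24$ root lattices $R$ in the formula below (products denote orthogonal sums), let $\Lambda_R$ be the Niemeier lattice with root lattice $R$, i.e. an even unimodular lattice of rank $24$ whose root lattice is isometric to $R$; for $R=0$ this is the Leech lattice. (By Niemeier's classification these exist, are unique up to isometry, and are all the even unimodular lattices of rank $24$.) Write $\vartheta(R)=\vartheta_{\Lambda_R}$ and $\vartheta(\text{Leech})=\vartheta(0)$. Put $$\begin{aligned}g={}&\tfrac{1}{152769576960}\vartheta(\text{Leech})-\tfrac{1}{3183476736}\vartheta(A_1^{24})+\tfrac{1}{591224832}\vartheta(A_2^{12})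 \\ &-\tfrac{5}{1146617856}\vartheta(A_3^8)+\tfrac{13}{1990656000}\vartheta(A_4^6)-\tfrac{83}{11943936000}\vartheta(A_5^4D_4) \\ &+\tfrac{19}{16307453952}\vartheta(D_4^6)+\tfrac{41}{15676416000}\vartheta(A_6^4)-\tfrac{1}{37158912000}\vartheta(A_7^2D_5^2) \\ &-\tfrac{197}{351151718400}\vartheta(A_8^3)+\tfrac{59}{214990848000}\vartheta(A_9^2D_6)-\tfrac{13}{229323571200}\vartheta(D_6^4) \\ &-\tfrac{1}{35831808000}\vartheta(A_{11}D_7E_6)+\tfrac{1}{143327232000}\vartheta(E_6^4)+\tfrac{31}{7685922816000}\vartheta(A_{12}^2) \\ &+\tfrac{37}{11415217766400}\vartheta(D_8^3)-\tfrac{29}{21069103104000}\vartheta(A_{15}D_9)-\tfrac{1}{7023034368000}\vartheta(D_{10}E_7^2) \\ &+\tfrac{1}{3511517184000}\vartheta(A_{17}E_7)+\tfrac{53}{4237899595776000}\vartheta(D_{12}^2)-\tfrac{1}{1332620771328000}\vartheta(A_{24}) \\ &-\tfrac{1}{3595793596416000}\vartheta(D_{16}E_8)+\tfrac{1}{10787380789248000}\vartheta(E_8^3)+\tfrac{1}{2729207339679744000}\vartheta(D_{24}).\end{aligned}$$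 Then: 1. The $24$ functions $\vartheta(R)$ on $\mathbb H_{12}$ are linearly independent over $\mathbb C$. 2. Every Siegel cusp form of degree $12$ and weight $12$ for $\mathrm{Sp}(24,\mathbb Z)$ that lies in the complex span of these $24$ functions is a constant multiple of $g$. 3. $g$ has an absolutely convergent Fourier expansion $g(Z)=\sum_T a(T)\exp(\pi i\,\mathrm{tr}(TZ))$ over the integral symmetric $12\times 12$ matrices $T$ with even diagonal, and $a(T)=1$ if $T$ is the Gram matrix of the lattice $D_{12}$ (in the basis of simple roots). -/

import Mathlib

open Complex Matrix Filter Topology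

/-! ### Even unimodular lattices and their root lattices -/

/-- A free abelian group of finite rank with an even, unimodular, positive definite
symmetric bilinear form. Unimodular means: `x ↦ B x ·` identifies `L` with its dual. -/
structure IsEvenUnimodular {L : Type*} [AddCommGroup L] (B : LinearMap.BilinForm ℤ L) : Prop where
  free : Module.Free ℤ L
  finite : Module.Finite ℤ L
  symm : ∀ x y, B x y = B y x
  posDef : ∀ x, x ≠ 0 → 0 < B x x
  even : ∀ x, Even (B x x)
  unimodular : Function.Bijective (B : L → Module.Dual ℤ L)

/-- The simply laced connected Dynkin diagrams. -/
inductive Dynkin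
  | A (n : ℕ)
  | D (n : ℕ)
  | E6
  | E7
  | E8

/-- The number of nodes of a Dynkin diagram. -/
def Dynkin.rank : Dynkin → ℕ
  | A n => n
  | D n => n
  | E6 => 6
  | E7 => 7
  | E8 => 8

/-- The Cartan matrix, which is the Gram matrix of a basis of the root lattice. -/
def Dynkin.cartan : (d : Dynkin) → Matrix (Fin d.rank) (Fin d.rank) ℤ
  | A n => CartanMatrix.A n
  | D n => CartanMatrix.D n
  | E6 => CartanMatrix.E₆
  | E7 => CartanMatrix.E₇
  | E8 => CartanMatrix.E₈

/-- The Gram matrix of the orthogonal sum of the root lattices in a list. -/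
def rootGram (R : List Dynkin) :
    Matrix (Σ k : Fin R.length, Fin (R.get k).rank) (Σ k : Fin R.length, Fin (R.get k).rank) ℤ :=
  Matrix.blockDiagonal' fun k => (R.get k).cartan

/-- The sublattice of `L` generated by the vectors of norm `2` is isometric to the orthogonal sum
of the root lattices in the list `R`: it is spanned by a family with Gram matrix `rootGram R`.
(Such a family is linearly independent, since `rootGram R` is nondegenerate.) -/
def HasRootLattice {L : Type*} [AddCommGroup L] (B : LinearMap.BilinForm ℤ L)
    (R : List Dynkin) : Prop :=
  ∃ b : (Σ k : Fin R.length, Fin (R.get k).rank) → L,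
    (∀ i j, B (b i) (b j) = rootGram R i j) ∧
    Submodule.span ℤ (Set.range b) = Submodule.span ℤ {x | B x x = 2}

/-- The Niemeier lattice with root lattice `R`: an even unimodular positive definite lattice of
rank `24` whose vectors of norm `2` generate a lattice of type `R`. -/
structure IsNiemeierLattice {L : Type*} [AddCommGroup L] (B : LinearMap.BilinForm ℤ L)
    (R : List Dynkin) : Prop extends IsEvenUnimodular B where
  rank_eq : Module.finrank ℤ L = 24
  roots : HasRootLattice B R

open Dynkin in
/-- The root lattices of the 24 Niemeier lattices in the order of their Coxeter numbers.
The empty list belongs to the Leech lattice. -/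
def niemeierRoots : Fin 24 → List Dynkin :=
  ![[],
    List.replicate 24 (A 1),
    List.replicate 12 (A 2),
    List.replicate 8 (A 3),
    List.replicate 6 (A 4),
    [A 5, A 5, A 5, A 5, D 4],
    List.replicate 6 (D 4),
    List.replicate 4 (A 6),
    [A 7, A 7, D 5, D 5],
    List.replicate 3 (A 8),
    [A 9, A 9, D 6],
    List.replicate 4 (D 6),
    [A 11, D 7, E6],
    List.replicate 4 E6,
    [A 12, A 12],
    List.replicate 3 (D 8),
    [A 15, D 9],
    [D 10, E7, E7],
    [A 17, E7],
    [D 12, D 12],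
    [A 24],
    [D 16, E8],
    List.replicate 3 E8,
    [D 24]]

/-! ### Siegel modular forms -/

/-- The Siegel upper half space of degree `n`: symmetric complex matrices with positive definite
imaginary part. -/
def siegelSet (n : ℕ) : Set (Matrix (Fin n) (Fin n) ℂ) :=
  {Z | Z.IsSymm ∧ (Z.map Complex.im).PosDef}

/-- The Siegel upper half space as a type. -/
abbrev SiegelSpace (n : ℕ) : Type := siegelSet n

/-- The matrix with diagonal blocks `Z` and `i t`. -/
noncomputable def borderMatrix {n : ℕ} (Z : Matrix (Fin n) (Fin n) ℂ) (t : ℝ) :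
    Matrix (Fin (n + 1)) (Fin (n + 1)) ℂ :=
  Matrix.reindex finSumFinEquiv finSumFinEquiv
    (Matrix.fromBlocks Z 0 0 (Matrix.diagonal fun _ : Fin 1 => I * (t : ℂ)))

theorem borderMatrix_mem {n : ℕ} {Z : Matrix (Fin n) (Fin n) ℂ} (hZ : Z ∈ siegelSet n)
    {t : ℝ} (ht : 0 < t) : borderMatrix Z t ∈ siegelSet (n + 1) := by
  obtain ⟨hs, hp⟩ := hZ
  have him : (Matrix.fromBlocks Z 0 0 (Matrix.diagonal fun _ : Fin 1 => I * (t : ℂ))).map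
      Complex.im = Matrix.fromBlocks (Z.map Complex.im) 0 0 (Matrix.diagonal fun _ => t) := by
    ext i j
    rcases i with i | i <;> rcases j with j | j <;> simp [Matrix.diagonal_apply]
    split_ifs <;> simp
  refine ⟨?_, ?_⟩
  · exact (Matrix.IsSymm.fromBlocks hs Matrix.transpose_zero
      (Matrix.isSymm_diagonal fun _ : Fin 1 => I * (t : ℂ))).submatrix _
  · rw [borderMatrix, Matrix.reindex_apply, ← Matrix.submatrix_map, him]
    refine Matrix.PosDef.submatrix ?_ (Equiv.injective _)
    refine Matrix.PosDef.of_dotProduct_mulVec_pos ?_ fun x hx => ?_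
    · exact Matrix.IsHermitian.fromBlocks hp.1 (by simp)
        (by simp [Matrix.IsHermitian])
    · obtain ⟨u, v, rfl⟩ : ∃ u v, x = Sum.elim u v :=
        ⟨x ∘ Sum.inl, x ∘ Sum.inr, (Sum.elim_comp_inl_inr x).symm⟩
      have h1 : star (Sum.elim u v) ⬝ᵥ
          (Matrix.fromBlocks (Z.map Complex.im) 0 0 (Matrix.diagonal fun _ => t) *ᵥ Sum.elim u v)
          = star u ⬝ᵥ (Z.map Complex.im *ᵥ u) + t * (v 0 * v 0) := by
        simp [Matrix.fromBlocks_mulVec, dotProduct, Fintype.sum_sum_type]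
        ring
      rw [h1]
      by_cases hu : u = 0
      · have hv : v 0 ≠ 0 := by
          intro h
          apply hx
          ext i
          rcases i with i | i
          · simp [hu]
          · simpa [Subsingleton.elim i 0] using h
        subst hu
        have := mul_pos ht (mul_self_pos.2 hv)
        simpa using this
      · have := hp.dotProduct_mulVec_pos hu
        have h2 := mul_nonneg ht.le (mul_self_nonneg (v 0))
        linarith

/-- The point of the Siegel space of degree `n + 1` with diagonal blocks `Z` and `i t`. -/
noncomputable def border {n : ℕ} (Z : SiegelSpace n) (t : Set.Ioi (0 : ℝ)) :
    SiegelSpace (n + 1) :=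
  ⟨borderMatrix Z.1 t.1, borderMatrix_mem Z.2 t.2⟩

/-- Siegel modular forms of degree `n` and weight `k` for the full group `Sp(2n, ℤ)`. -/
structure IsSiegelModularForm {n : ℕ} (k : ℤ) (f : SiegelSpace n → ℂ) : Prop where
  /-- Complex differentiability along the symmetric matrices. -/
  holomorphic : DifferentiableOn ℂ (Function.extend Subtype.val f 0) (siegelSet n)
  /-- `f ((A Z + B) (C Z + D)⁻¹) = det (C Z + D) ^ k f(Z)`. Here `C Z + D` is always invertible,
  and the transformed matrix `W` always lies in the Siegel space. -/
  modular : ∀ M ∈ Matrix.symplecticGroup (Fin n) ℤ, ∀ Z W : SiegelSpace n,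
    let A := M.toBlocks₁₁.map (Int.cast : ℤ → ℂ)
    let B := M.toBlocks₁₂.map (Int.cast : ℤ → ℂ)
    let C := M.toBlocks₂₁.map (Int.cast : ℤ → ℂ)
    let D := M.toBlocks₂₂.map (Int.cast : ℤ → ℂ)
    W.1 = (A * Z.1 + B) * (C * Z.1 + D)⁻¹ → f W = (C * Z.1 + D).det ^ k * f Z
  /-- Regularity at the cusp; for `n ≥ 2` this follows from the other conditions. -/
  bounded : ∀ c : ℝ, 0 < c → ∃ K : ℝ, ∀ Z : SiegelSpace n,
    (Z.1.map Complex.im - c • (1 : Matrix (Fin n) (Fin n) ℝ)).PosSemidef → ‖f Z‖ ≤ K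

/-- Siegel cusp forms: modular forms that are annihilated by the Siegel operator
`(Φ f)(Z) = lim_{t → ∞} f (diag (Z, i t))`. -/
structure IsSiegelCuspForm {n : ℕ} (k : ℤ) (f : SiegelSpace (n + 1) → ℂ) : Prop
    extends IsSiegelModularForm k f where
  cusp : ∀ Z : SiegelSpace n, Tendsto (fun t => f (border Z t)) atTop (𝓝 0)

/-- Integral symmetric matrices with even diagonal. -/
abbrev EvenMatrix (n : ℕ) : Type :=
  {T : Matrix (Fin n) (Fin n) ℤ // T.IsSymm ∧ ∀ i, Even (T i i)}

/-- The function `Z ↦ exp (π i tr (T Z))`. -/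
noncomputable def expTrace {n : ℕ} (T : Matrix (Fin n) (Fin n) ℤ) (Z : SiegelSpace n) : ℂ :=
  Complex.exp (Real.pi * I * (T.map (Int.cast : ℤ → ℂ) * Z.1).trace)

/-- `f(Z) = ∑_T a(T) exp (π i tr (T Z))` for all `Z`, with absolute convergence. The coefficients
`a(T)` of such an expansion are unique. -/
def IsFourierExpansion {n : ℕ} (f : SiegelSpace n → ℂ) (a : EvenMatrix n → ℂ) : Prop :=
  ∀ Z, HasSum (fun T : EvenMatrix n => a T * expTrace T.1 Z) (f Z)

/-- The Gram matrix of the lattice `D₁₂`. -/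
def gramD12 : EvenMatrix 12 :=
  ⟨CartanMatrix.D 12, CartanMatrix.D_isSymm 12, fun i => by simp⟩

/-! ### Theta series -/

/-- The matrix of inner products of `g₁, …, gₙ`. -/
def gramMatrix {L : Type*} [AddCommGroup L] (B : LinearMap.BilinForm ℤ L) {n : ℕ}
    (g : Fin n → L) : Matrix (Fin n) (Fin n) ℤ :=
  Matrix.of fun i j => B (g i) (g j)

/-- The theta series of degree `n`, the sum of `exp (π i tr (T(g) Z))` over all `g ∈ Lⁿ`. -/
noncomputable def theta (n : ℕ) {L : Type*} [AddCommGroup L] (B : LinearMap.BilinForm ℤ L) :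
    SiegelSpace n → ℂ :=
  fun Z => ∑' g : Fin n → L, expTrace (gramMatrix B g) Z

/-- The coefficients of the explicit combination, in the order of `niemeierRoots`. -/
def niemeierCoeff : Fin 24 → ℚ :=
  ![1 / 152769576960,
    -1 / 3183476736,
    1 / 591224832,
    -5 / 1146617856,
    13 / 1990656000,
    -83 / 11943936000,
    19 / 16307453952,
    41 / 15676416000,
    -1 / 37158912000,
    -197 / 351151718400,
    59 / 214990848000,
    -13 / 229323571200,
    -1 / 35831808000,
    1 / 143327232000,
    31 / 7685922816000,
    37 / 11415217766400,
    -29 / 21069103104000,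
    -1 / 7023034368000,
    1 / 3511517184000,
    53 / 4237899595776000,
    -1 / 1332620771328000,
    -1 / 3595793596416000,
    1 / 10787380789248000,
    1 / 2729207339679744000]

/-- The explicit rational combination of the degree 12 theta series of the Niemeier lattices. -/
noncomputable def niemeierForm {L : Fin 24 → Type*} [∀ i, AddCommGroup (L i)]
    (B : ∀ i, LinearMap.BilinForm ℤ (L i)) : SiegelSpace 12 → ℂ :=
  ∑ i, (niemeierCoeff i : ℂ) • theta 12 (B i)

/-! ### Convergence of theta series -/

/-! The Siegel operator sends the degree 12 theta series of a lattice to its degree 11 theta series.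
Hence a combination `∑ c_i ϑ_i` that the operator annihilates gives the relation `∑ c_i ϑ_i = 0` in
degree 11. Comparing Fourier coefficients, `∑ c_i r_i(T) = 0` for every 11 × 11 matrix `T`, where
`r_i(T)` counts the tuples with Gram matrix `T` (`tendsto_theta_border`, `sum_mul_card_eq_zero`).

Summing over suitable `T` turns this into relations between two numerical invariants: the number
`N_i` of roots and the number `Q_i` of quadruples of roots with Gram matrix `D₄`. Among 11 vectors
there is room for `a` roots and `b` such quadruples if `a + 4b ≤ 11`. If nothing is prescribed
between different blocks, the count factors, so `∑ c_i N_i^a Q_i^b = 0`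
(`sum_mul_rootCount_pow_mul_gramCount_pow`). There are 12 + 8 + 4 = 24 such monomials. Their matrix
of values on the 24 lattices has rank 23, and its left kernel is spanned by the explicit
coefficients (`exists_smul_niemeierCoeff_of_sum_eq_zero`). So any combination annihilated by the
Siegel operator is a multiple of the explicit one, and this covers all cusp forms in the span.

The `D₁₂` coefficient of the explicit form is a rational combination of the numbers of `D₁₂` tuples,
and it equals 1. A vanishing combination of the degree 12 series is in particular annihilated by the
Siegel operator, so it is `z` times the explicit form; its `D₁₂` coefficient is then `z`, whence `z
= 0` and the series are independent.

All tuples counted consist of roots and have a connected diagram, so each lies in one component of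
the root lattice and the counts add over components (`HasRootLattice.gramCount_eq`). For types `A`
and `D` they come from signed permutations of an orthonormal basis, and for type `E` from finite
enumeration together with transitivity of reflections on roots. -/

theorem summable_prod_pi {α : Type*} {f : α → ℝ} (hf : Summable f) (h0 : ∀ a, 0 ≤ f a) (n : ℕ) :
    Summable fun g : Fin n → α => ∏ i, f (g i) := by
  induction n with
  | zero => exact Summable.of_finite
  | succ n ih =>
    rw [← (Fin.consEquiv fun _ : Fin (n + 1) => α).summable_iff]
    have := hf.mul_of_nonneg ih h0 fun g => Finset.prod_nonneg fun i _ => h0 _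
    refine this.congr fun p => ?_
    simp [Fin.consEquiv, Fin.prod_univ_succ]

theorem summable_exp_neg_mul_sq_int {c : ℝ} (hc : 0 < c) :
    Summable fun m : ℤ => Real.exp (-(c * (m : ℝ) ^ 2)) := by
  -- The Jacobi bound with linear term 0, exponent 0 and quadratic parameter `c / π` is exactly this
  -- Gaussian.
  refine (summable_pow_mul_jacobiTheta₂_term_bound 0 (div_pos hc Real.pi_pos) 0).congr fun m => ?_
  rw [pow_zero, one_mul]
  congr 1
  field_simp
  ring

/-- The constant is the least eigenvalue: diagonalising `Y` makes `Y - c` a nonnegative diagonal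
matrix. In size 0 any positive constant serves. -/
theorem Matrix.PosDef.exists_smul_one_le {n : ℕ} {Y : Matrix (Fin n) (Fin n) ℝ} (hY : Y.PosDef) :
    ∃ c : ℝ, 0 < c ∧ (Y - c • (1 : Matrix (Fin n) (Fin n) ℝ)).PosSemidef := by
  obtain ⟨c, hc, hle⟩ : ∃ c : ℝ, 0 < c ∧ ∀ i, c ≤ hY.1.eigenvalues i := by
    rcases isEmpty_or_nonempty (Fin n) with h | h
    · exact ⟨1, one_pos, fun i => h.elim i⟩
    · obtain ⟨i, hi⟩ := Finite.exists_min hY.1.eigenvalues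
      exact ⟨_, hY.eigenvalues_pos i, hi⟩
  refine ⟨c, hc, ?_⟩
  have hU : (hY.1.eigenvectorUnitary : Matrix (Fin n) (Fin n) ℝ) *
      (hY.1.eigenvectorUnitary : Matrix (Fin n) (Fin n) ℝ)ᴴ = 1 := by
    rw [← star_eq_conjTranspose]; simp
  have h := hY.1.spectral_theorem
  rw [Unitary.conjStarAlgAut_apply, star_eq_conjTranspose] at h
  have h2 : Y - c • (1 : Matrix (Fin n) (Fin n) ℝ) = (hY.1.eigenvectorUnitary : Matrix _ _ ℝ) *
      diagonal (fun i => hY.1.eigenvalues i - c) *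
      (hY.1.eigenvectorUnitary : Matrix (Fin n) (Fin n) ℝ)ᴴ := by
    have h3 : diagonal (fun i => hY.1.eigenvalues i - c) =
        diagonal (RCLike.ofReal ∘ hY.1.eigenvalues) - c • (1 : Matrix (Fin n) (Fin n) ℝ) := by
      ext i j
      by_cases hij : i = j <;> simp [hij]
    rw [h3, Matrix.mul_sub, Matrix.sub_mul, ← h, Matrix.mul_smul, Matrix.mul_one, Matrix.smul_mul,
      hU]
  rw [h2]
  exact (PosSemidef.diagonal fun i => sub_nonneg.2 (hle i)).mul_mul_conjTranspose_same _

/-- Writing `Q = Sᴴ S` gives `tr(PQ) = tr(S P Sᴴ)`. -/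
theorem Matrix.PosSemidef.trace_mul_nonneg {ι : Type*} [Fintype ι] [DecidableEq ι]
    {P Q : Matrix ι ι ℝ} (hP : P.PosSemidef) (hQ : Q.PosSemidef) : 0 ≤ (P * Q).trace := by
  obtain ⟨S, rfl⟩ : ∃ S : Matrix ι ι ℝ, Q = Sᴴ * S := by
    open scoped MatrixOrder in
    exact CStarAlgebra.nonneg_iff_eq_star_mul_self.1 hQ.nonneg
  rw [← Matrix.mul_assoc, Matrix.trace_mul_comm, ← Matrix.mul_assoc]
  exact (hP.mul_mul_conjTranspose_same S).trace_nonneg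

theorem tendsto_floor_mul_div_atTop (a : ℝ) :
    Tendsto (fun N : ℕ => (⌊(N : ℝ) * a⌋ : ℝ) / N) atTop (𝓝 a) := by
  have h1 : Tendsto (fun N : ℕ => a - 1 / (N : ℝ)) atTop (𝓝 a) := by
    simpa using (tendsto_const_nhds (x := a)).sub (tendsto_one_div_atTop_nhds_zero_nat (𝕜 := ℝ))
  refine tendsto_of_tendsto_of_tendsto_of_le_of_le' h1 tendsto_const_nhds ?_ ?_
  · filter_upwards [eventually_gt_atTop 0] with N hN
    have hN' : (0 : ℝ) < N := by exact_mod_cast hN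
    rw [le_div_iff₀ hN', sub_mul, one_div, inv_mul_cancel₀ hN'.ne']
    have := (Int.sub_one_lt_floor ((N : ℝ) * a)).le
    linarith
  · filter_upwards [eventually_gt_atTop 0] with N hN
    have hN' : (0 : ℝ) < N := by exact_mod_cast hN
    rw [div_le_iff₀ hN']
    have := Int.floor_le ((N : ℝ) * a)
    linarith

/-! ### Positivity, discreteness and Gaussian sums of even unimodular lattices -/

section Lattice

variable {L : Type*} [AddCommGroup L] {B : LinearMap.BilinForm ℤ L}

theorem IsEvenUnimodular.nonneg (h : IsEvenUnimodular B) (x : L) : 0 ≤ B x x := by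
  by_cases hx : x = 0
  · simp [hx]
  · exact (h.posDef x hx).le

theorem IsEvenUnimodular.eq_zero (h : IsEvenUnimodular B) {x : L} (hx : B x x = 0) : x = 0 := by
  by_contra h0
  exact (h.posDef x h0).ne' hx

/-- Positivity over `ℤ` passes to real coefficients by approximating `y i` with `⌊N y i⌋ / N`; the
lattice is never extended to a real vector space. -/
theorem IsEvenUnimodular.real_nonneg (h : IsEvenUnimodular B) {n : ℕ} (g : Fin n → L)
    (y : Fin n → ℝ) : 0 ≤ ∑ i, ∑ j, y i * y j * (B (g i) (g j) : ℝ) := by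
  have hlim : Tendsto (fun N : ℕ => ∑ i, ∑ j, ((⌊(N : ℝ) * y i⌋ : ℝ) / N) *
      ((⌊(N : ℝ) * y j⌋ : ℝ) / N) * (B (g i) (g j) : ℝ)) atTop
      (𝓝 (∑ i, ∑ j, y i * y j * (B (g i) (g j) : ℝ))) :=
    tendsto_finsetSum _ fun i _ => tendsto_finsetSum _ fun j _ =>
      ((tendsto_floor_mul_div_atTop _).mul (tendsto_floor_mul_div_atTop _)).mul_const _
  refine ge_of_tendsto' hlim fun N => ?_
  have h1 := h.nonneg (∑ i, ⌊(N : ℝ) * y i⌋ • g i)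
  have h2 : ∑ i, ∑ j, ((⌊(N : ℝ) * y i⌋ : ℝ) / N) * ((⌊(N : ℝ) * y j⌋ : ℝ) / N) *
      (B (g i) (g j) : ℝ) = ((B (∑ i, ⌊(N : ℝ) * y i⌋ • g i) (∑ i, ⌊(N : ℝ) * y i⌋ • g i) : ℤ) : ℝ)
        * ((N : ℝ)⁻¹ * (N : ℝ)⁻¹) := by
    simp only [map_sum, LinearMap.sum_apply, map_smul, LinearMap.smul_apply, smul_eq_mul,
      Int.cast_sum, Int.cast_mul, Finset.sum_mul, Finset.mul_sum]
    rw [Finset.sum_comm]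
    refine Finset.sum_congr rfl fun i _ => Finset.sum_congr rfl fun j _ => ?_
    ring
  rw [h2]
  have h3 : (0 : ℝ) ≤ ((B (∑ i, ⌊(N : ℝ) * y i⌋ • g i) (∑ i, ⌊(N : ℝ) * y i⌋ • g i) : ℤ) : ℝ) := by
    exact_mod_cast h1
  positivity

theorem IsEvenUnimodular.gramMatrix_posSemidef (h : IsEvenUnimodular B) {n : ℕ} (g : Fin n → L) :
    ((gramMatrix B g).map (Int.cast : ℤ → ℝ)).PosSemidef := by
  refine PosSemidef.of_dotProduct_mulVec_nonneg ?_ fun y => ?_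
  · ext i j
    simp [gramMatrix, h.symm (g i) (g j)]
  · refine (h.real_nonneg g y).trans_eq ?_
    simp only [dotProduct, mulVec, Finset.mul_sum, gramMatrix]
    refine Finset.sum_congr rfl fun i _ => Finset.sum_congr rfl fun j _ => ?_
    simp
    ring

/-- By unimodularity each coordinate functional is `B (y i)` for some lattice vector `y i`, and
Cauchy–Schwarz bounds the square of the coordinate by `B (y i) (y i) * B x x`. -/
theorem IsEvenUnimodular.exists_sum_sq_repr_le (h : IsEvenUnimodular B) :
    ∃ (r : ℕ) (b : Module.Basis (Fin r) ℤ L) (K : ℝ), 0 < K ∧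
      ∀ x, ∑ i, (b.repr x i : ℝ) ^ 2 ≤ K * (B x x : ℝ) := by
  have := h.free
  have := h.finite
  let b := Module.finBasis ℤ L
  choose y hy using fun i => h.unimodular.2 (b.coord i)
  have hs : LinearMap.IsSymm B := ⟨fun x y => by simp [h.symm x y]⟩
  have hle : ∀ x i, (b.repr x i) ^ 2 ≤ B (y i) (y i) * B x x := fun x i => by
    have := LinearMap.BilinForm.apply_sq_le_of_symm B h.nonneg hs (y i) x
    rwa [show B (y i) x = b.repr x i by rw [hy i, Module.Basis.coord_apply]] at this
  refine ⟨_, b, 1 + ∑ i, (B (y i) (y i) : ℝ), ?_, fun x => ?_⟩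
  · have : 0 ≤ ∑ i, (B (y i) (y i) : ℝ) :=
      Finset.sum_nonneg fun i _ => by exact_mod_cast h.nonneg (y i)
    linarith
  · rw [add_mul, one_mul, Finset.sum_mul]
    have h0 : (0 : ℝ) ≤ B x x := by exact_mod_cast h.nonneg x
    have : ∑ i, (b.repr x i : ℝ) ^ 2 ≤ ∑ i, (B (y i) (y i) : ℝ) * (B x x : ℝ) :=
      Finset.sum_le_sum fun i _ => by exact_mod_cast hle x i
    linarith

theorem IsEvenUnimodular.summable_exp_neg (h : IsEvenUnimodular B) {c : ℝ} (hc : 0 < c) :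
    Summable fun x : L => Real.exp (-(c * (B x x : ℝ))) := by
  obtain ⟨r, b, K, hK, hle⟩ := h.exists_sum_sq_repr_le
  have h1 := summable_prod_pi (summable_exp_neg_mul_sq_int (c := c / K) (by positivity))
    (fun m => (Real.exp_pos _).le) r
  rw [← b.equivFun.toEquiv.summable_iff] at h1
  refine h1.of_nonneg_of_le (fun x => (Real.exp_pos _).le) fun x => ?_
  simp only [Function.comp, LinearEquiv.coe_toEquiv, Module.Basis.equivFun_apply, ← Real.exp_sum]
  rw [Real.exp_le_exp, Finset.sum_neg_distrib, neg_le_neg_iff, ← Finset.mul_sum, div_mul_eq_mul_div,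
    div_le_iff₀ hK]
  nlinarith [hle x]

theorem norm_expTrace {n : ℕ} (T : Matrix (Fin n) (Fin n) ℤ) (Z : SiegelSpace n) :
    ‖expTrace T Z‖ =
      Real.exp (-(Real.pi * (T.map (Int.cast : ℤ → ℝ) * Z.1.map Complex.im).trace)) := by
  rw [expTrace, Complex.norm_exp]
  congr 1
  simp [Matrix.trace, Matrix.mul_apply, Complex.mul_re, Finset.mul_sum]

/-- With `Im Z ≥ c > 0`, the norm of each term is at most `∏ exp(-π c (g_i, g_i))`, so the sum is
dominated by a power of a one-variable lattice Gaussian. -/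
theorem IsEvenUnimodular.summable_norm_expTrace (h : IsEvenUnimodular B) {n : ℕ}
    (Z : SiegelSpace n) : Summable fun g : Fin n → L => ‖expTrace (gramMatrix B g) Z‖ := by
  obtain ⟨c, hc, hY⟩ := Z.2.2.exists_smul_one_le
  refine (summable_prod_pi (h.summable_exp_neg (mul_pos Real.pi_pos hc))
    (fun x => (Real.exp_pos _).le) n).of_nonneg_of_le (fun _ => norm_nonneg _) fun g => ?_
  rw [norm_expTrace, ← Real.exp_sum, Real.exp_le_exp, Finset.sum_neg_distrib, neg_le_neg_iff]
  have h1 := (h.gramMatrix_posSemidef g).trace_mul_nonneg hY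
  rw [Matrix.mul_sub, Matrix.trace_sub, Matrix.mul_smul, Matrix.mul_one, Matrix.trace_smul] at h1
  have h2 : ((gramMatrix B g).map (Int.cast : ℤ → ℝ)).trace = ∑ i, (B (g i) (g i) : ℝ) := by
    simp [Matrix.trace, gramMatrix]
  rw [h2, smul_eq_mul] at h1
  rw [← Finset.mul_sum, mul_assoc]
  exact mul_le_mul_of_nonneg_left (by linarith) Real.pi_pos.le

theorem IsEvenUnimodular.summable_expTrace (h : IsEvenUnimodular B) {n : ℕ}
    (Z : SiegelSpace n) : Summable fun g : Fin n → L => expTrace (gramMatrix B g) Z :=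
  (h.summable_norm_expTrace Z).of_norm

/-- The terms `exp(-B x x)` are summable, so only finitely many exceed a given positive bound. -/
theorem IsEvenUnimodular.finite_norm_le (h : IsEvenUnimodular B) (m : ℤ) :
    {x : L | B x x ≤ m}.Finite := by
  have h1 := (h.summable_exp_neg one_pos).tendsto_cofinite_zero
  have h2 := (h1.eventually (gt_mem_nhds (Real.exp_pos (-(m : ℝ)))))
  refine Set.Finite.subset (Filter.eventually_cofinite.1 h2) fun x hx => ?_
  simp only [Set.mem_ofPred_eq, not_lt, Real.exp_le_exp, one_mul, neg_le_neg_iff] at hx ⊢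
  exact_mod_cast hx

end Lattice

/-! ### The Siegel operator on theta series -/

section Border

variable {n : ℕ} (Z : Matrix (Fin n) (Fin n) ℂ) (t : ℝ)

theorem borderMatrix_castSucc_castSucc (i j : Fin n) :
    borderMatrix Z t i.castSucc j.castSucc = Z i j := by
  rw [borderMatrix, Matrix.reindex_apply, Matrix.submatrix_apply, show i.castSucc = Fin.castAdd 1 i from rfl,
    show j.castSucc = Fin.castAdd 1 j from rfl, finSumFinEquiv_symm_apply_castAdd, finSumFinEquiv_symm_apply_castAdd,
    Matrix.fromBlocks_apply₁₁]

theorem borderMatrix_castSucc_last (i : Fin n) :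
    borderMatrix Z t i.castSucc (Fin.last n) = 0 := by
  rw [borderMatrix, Matrix.reindex_apply, Matrix.submatrix_apply, show i.castSucc = Fin.castAdd 1 i from rfl,
    finSumFinEquiv_symm_apply_castAdd, finSumFinEquiv_symm_last, Matrix.fromBlocks_apply₁₂,
    Matrix.zero_apply]

theorem borderMatrix_last_castSucc (i : Fin n) :
    borderMatrix Z t (Fin.last n) i.castSucc = 0 := by
  rw [borderMatrix, Matrix.reindex_apply, Matrix.submatrix_apply, show i.castSucc = Fin.castAdd 1 i from rfl,
    finSumFinEquiv_symm_apply_castAdd, finSumFinEquiv_symm_last, Matrix.fromBlocks_apply₂₁,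
    Matrix.zero_apply]

theorem borderMatrix_last_last : borderMatrix Z t (Fin.last n) (Fin.last n) = I * t := by
  rw [borderMatrix, Matrix.reindex_apply, Matrix.submatrix_apply, finSumFinEquiv_symm_last,
    Matrix.fromBlocks_apply₂₂, Matrix.diagonal_apply_eq]

end Border

theorem expTrace_border {n : ℕ} (T : Matrix (Fin (n + 1)) (Fin (n + 1)) ℤ) (Z : SiegelSpace n)
    (t : Set.Ioi (0 : ℝ)) :
    expTrace T (border Z t) = expTrace (T.submatrix Fin.castSucc Fin.castSucc) Z *
      (Real.exp (-(Real.pi * T (Fin.last n) (Fin.last n) * t)) : ℝ) := by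
  rw [expTrace, expTrace, ofReal_exp, ← Complex.exp_add]
  congr 1
  simp only [border, Matrix.trace, Matrix.diag, Matrix.mul_apply, Fin.sum_univ_castSucc,
    borderMatrix_castSucc_castSucc, borderMatrix_castSucc_last, borderMatrix_last_castSucc,
    borderMatrix_last_last, Matrix.map_apply, Matrix.submatrix_apply, mul_zero, add_zero,
    Finset.sum_const_zero, zero_add]
  push_cast
  linear_combination (Real.pi * (T (Fin.last n) (Fin.last n) : ℂ) * (t : ℝ)) * I_sq

section Lattice

variable {L : Type*} [AddCommGroup L] {B : LinearMap.BilinForm ℤ L}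

-- Tuples whose last vector is zero contribute the theta series of degree `n`, independently of `t`.
-- All other terms decay exponentially in `t`.
open scoped Classical in
theorem IsEvenUnimodular.tendsto_theta_border (h : IsEvenUnimodular B) {n : ℕ}
    (Z : SiegelSpace n) :
    Tendsto (fun t => theta (n + 1) B (border Z t)) atTop (𝓝 (theta n B Z)) := by
  have hlim : theta n B Z = ∑' g : Fin (n + 1) → L,
      if g (Fin.last n) = 0 then expTrace (gramMatrix B (g ∘ Fin.castSucc)) Z else 0 := by
    have hinj : Function.Injective fun g : Fin n → L => (Fin.snoc g 0 : Fin (n + 1) → L) :=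
      fun g g' hg => (Fin.snoc_inj.1 hg).1
    rw [theta, ← hinj.tsum_eq]
    · refine tsum_congr fun g => ?_
      have : (Fin.snoc g 0 : Fin (n + 1) → L) ∘ Fin.castSucc = g := by
        ext i; exact Fin.snoc_castSucc (α := fun _ => L) _ _ _
      rw [if_pos (Fin.snoc_last _ _), this]
    · intro g hg
      have hg0 : g (Fin.last n) = 0 := by
        by_contra h0
        simp [h0] at hg
      refine ⟨g ∘ Fin.castSucc, ?_⟩
      rw [← hg0]
      exact Fin.snoc_init_self g
  rw [hlim]
  -- For `t ≥ 1` the norms at `t = 1` dominate.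
  refine tendsto_tsum_of_dominated_convergence (h.summable_norm_expTrace (border Z ⟨1, Set.mem_Ioi.2 one_pos⟩))
    (fun g => ?_) ?_
  · simp only [expTrace_border]
    by_cases h0 : g (Fin.last n) = 0
    · have : gramMatrix B g (Fin.last n) (Fin.last n) = 0 := by simp [gramMatrix, h0]
      simp only [this, h0, if_true]
      simp only [Int.cast_zero, mul_zero, zero_mul, neg_zero, Real.exp_zero, ofReal_one, mul_one]
      exact tendsto_const_nhds
    · rw [if_neg h0]
      have hpos : (0 : ℝ) < Real.pi * gramMatrix B g (Fin.last n) (Fin.last n) :=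
        mul_pos Real.pi_pos (by exact_mod_cast h.posDef _ h0)
      have h1 : Tendsto (fun t : Set.Ioi (0 : ℝ) =>
          Real.exp (-(Real.pi * gramMatrix B g (Fin.last n) (Fin.last n) * t))) atTop (𝓝 0) := by
        refine Real.tendsto_exp_neg_atTop_nhds_zero.comp ?_
        exact (tendsto_comp_val_Ioi_atTop.2 tendsto_id).const_mul_atTop hpos
      have h2 := ((Complex.continuous_ofReal.tendsto 0).comp h1).const_mul
        (expTrace ((gramMatrix B g).submatrix Fin.castSucc Fin.castSucc) Z)
      simpa using h2
  · filter_upwards [eventually_ge_atTop (⟨1, Set.mem_Ioi.2 one_pos⟩ : Set.Ioi (0 : ℝ))] with t ht g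
    have ht' : (1 : ℝ) ≤ t := ht
    rw [expTrace_border, expTrace_border, norm_mul, norm_mul]
    refine mul_le_mul_of_nonneg_left ?_ (norm_nonneg _)
    rw [Complex.norm_real, Complex.norm_real, Real.norm_of_nonneg (Real.exp_pos _).le,
      Real.norm_of_nonneg (Real.exp_pos _).le, Real.exp_le_exp, neg_le_neg_iff]
    have : (0 : ℝ) ≤ gramMatrix B g (Fin.last n) (Fin.last n) := by
      exact_mod_cast h.nonneg (g (Fin.last n))
    exact mul_le_mul_of_nonneg_left ht' (by positivity)

end Lattice

/-! ### Extraction of Fourier coefficients -/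

theorem tendsto_average_pow {z : ℂ} (hz : ‖z‖ = 1) :
    Tendsto (fun M : ℕ => (M : ℂ)⁻¹ * ∑ m ∈ Finset.range M, z ^ m) atTop
      (𝓝 (if z = 1 then 1 else 0)) := by
  split_ifs with h
  · subst h
    refine tendsto_const_nhds.congr' ?_
    filter_upwards [eventually_gt_atTop 0] with M hM
    have : (M : ℂ) ≠ 0 := by exact_mod_cast hM.ne'
    simp [this]
  · have h1 : Tendsto (fun M : ℕ => (M : ℝ)⁻¹ * (2 / ‖z - 1‖)) atTop (𝓝 0) := by
      simpa using (tendsto_inv_atTop_nhds_zero_nat (𝕜 := ℝ)).mul_const (2 / ‖z - 1‖)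
    refine squeeze_zero_norm (fun M => ?_) h1
    rw [norm_mul, norm_inv, Complex.norm_natCast, geom_sum_eq h, norm_div]
    gcongr
    refine (norm_sub_le _ _).trans ?_
    rw [norm_pow, hz, one_pow, norm_one]
    norm_num

/-- Averaging over powers of the phases isolates the terms with phase 1. It replaces integration
over a torus, and needs only dominated convergence and a bounded geometric sum. -/
theorem tendsto_average_tsum {ι : Type*} {w z : ι → ℂ} (hw : Summable fun g => ‖w g‖)
    (hz : ∀ g, ‖z g‖ = 1) :
    Tendsto (fun M : ℕ => (M : ℂ)⁻¹ * ∑ m ∈ Finset.range M, ∑' g, w g * z g ^ m) atTop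
      (𝓝 (∑' g, if z g = 1 then w g else 0)) := by
  have hs : ∀ m : ℕ, Summable fun g => w g * z g ^ m := fun m =>
    (hw.congr fun g => by rw [norm_mul, norm_pow, hz, one_pow, mul_one]).of_norm
  have heq : ∀ M : ℕ, (M : ℂ)⁻¹ * ∑ m ∈ Finset.range M, ∑' g, w g * z g ^ m =
      ∑' g, w g * ((M : ℂ)⁻¹ * ∑ m ∈ Finset.range M, z g ^ m) := fun M => by
    rw [← Summable.tsum_finsetSum fun m _ => hs m, ← tsum_mul_left]
    refine tsum_congr fun g => ?_
    rw [← Finset.mul_sum]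
    ring
  simp only [heq]
  refine tendsto_tsum_of_dominated_convergence hw (fun g => ?_) (Eventually.of_forall fun M g => ?_)
  · have := (tendsto_average_pow (hz g)).const_mul (w g)
    simpa using this
  · rw [norm_mul]
    refine mul_le_of_le_one_right (norm_nonneg _) ?_
    rw [norm_mul, norm_inv, Complex.norm_natCast]
    have h1 : ‖∑ m ∈ Finset.range M, z g ^ m‖ ≤ M := by
      refine (norm_sum_le _ _).trans ?_
      simp [hz]
    rcases Nat.eq_zero_or_pos M with rfl | hM
    · simp
    · have hM' : (0 : ℝ) < M := by exact_mod_cast hM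
      rw [inv_mul_le_iff₀ hM', mul_one]
      exact h1

/-- An injective numbering of the unordered pairs of natural numbers by positive integers. -/
def pairIndex (a b : ℕ) : ℕ := Nat.pair (min a b) (max a b) + 1

/-- A symmetric real matrix whose entries on and above the diagonal are distinct positive powers
of a transcendental number. -/
noncomputable def genericMatrix (n : ℕ) : Matrix (Fin n) (Fin n) ℝ :=
  Matrix.of fun i j => liouvilleNumber 2 ^ (pairIndex i j)

theorem pairIndex_inj {a b c d : ℕ} (h : pairIndex a b = pairIndex c d) :
    (a = c ∧ b = d) ∨ (a = d ∧ b = c) := by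
  have := Nat.pair_eq_pair.1 (Nat.succ_injective h)
  omega

theorem pairIndex_comm (a b : ℕ) : pairIndex a b = pairIndex b a := by
  rw [pairIndex, pairIndex, min_comm, max_comm]

/-- The trace is an integral polynomial without constant term in a transcendental number, so being
an integer forces all its coefficients to vanish. By symmetry the coefficient belonging to a pair of
indices is the entry of `T`, taken once or twice. -/
theorem eq_zero_of_trace_mul_genericMatrix {n : ℕ} {T : Matrix (Fin n) (Fin n) ℤ} (hT : T.IsSymm)
    {k : ℤ} (h : (T.map (Int.cast : ℤ → ℝ) * genericMatrix n).trace = k) : T = 0 := by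
  open Polynomial in
  let p : ℤ[X] := ∑ i, ∑ j, C (T i j) * X ^ (pairIndex i j) - C k
  have hp : p = 0 := by
    by_contra hp0
    refine transcendental_liouvilleNumber (m := 2) le_rfl ⟨p, hp0, ?_⟩
    simp only [p, map_sub, map_sum, map_mul, map_pow, Polynomial.aeval_X, Polynomial.aeval_C]
    rw [sub_eq_zero]
    refine Eq.trans ?_ h
    simp only [Matrix.trace, Matrix.diag, Matrix.mul_apply, genericMatrix, Matrix.of_apply,
      Matrix.map_apply]
    refine Finset.sum_congr rfl fun i _ => Finset.sum_congr rfl fun j _ => ?_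
    simp [pairIndex_comm]
  ext a b
  have h1 := congrArg (fun q => Polynomial.coeff q (pairIndex a b)) hp
  have h2 : (pairIndex a b) ≠ 0 := Nat.succ_ne_zero _
  simp only [p, Polynomial.coeff_sub, Polynomial.finsetSum_coeff, Polynomial.coeff_C_mul,
    Polynomial.coeff_X_pow, Polynomial.coeff_C, h2, if_false, sub_zero, Polynomial.coeff_zero] at h1
  have h3 : ∀ i j : Fin n, (T i j * if pairIndex a b = pairIndex i j
      then (1 : ℤ) else 0) = T a b * if (i = a ∧ j = b) ∨ (i = b ∧ j = a) then 1 else 0 := by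
    intro i j
    by_cases hc : pairIndex a b = pairIndex i j
    · rcases pairIndex_inj hc with ⟨h4, h5⟩ | ⟨h4, h5⟩
      · obtain rfl := Fin.ext h4
        obtain rfl := Fin.ext h5
        simp
      · obtain rfl := Fin.ext h4
        obtain rfl := Fin.ext h5
        simp [pairIndex_comm a b, hT.apply a b]
    · have : ¬ ((i = a ∧ j = b) ∨ (i = b ∧ j = a)) := by
        rintro (⟨rfl, rfl⟩ | ⟨rfl, rfl⟩)
        · exact hc rfl
        · exact hc (pairIndex_comm _ _)
      simp [hc, this]
  simp only [h3, ← Finset.mul_sum] at h1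
  -- The remaining factor is the number of ordered pairs that represent `{a, b}`, which is 1 or 2.
  refine (mul_eq_zero.1 h1).resolve_right (ne_of_gt ?_)
  refine Finset.sum_pos' (fun i _ => Finset.sum_nonneg fun j _ => by split_ifs <;> simp)
    ⟨a, Finset.mem_univ _, Finset.sum_pos' (fun j _ => by split_ifs <;> simp)
      ⟨b, Finset.mem_univ _, by simp⟩⟩

/-- The translate of a point of the Siegel space by a multiple of `genericMatrix n`. -/
noncomputable def genericShift {n : ℕ} (Z : SiegelSpace n) (m : ℕ) : SiegelSpace n :=
  ⟨Z.1 + (m : ℂ) • (genericMatrix n).map ofReal, by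
    refine ⟨?_, ?_⟩
    · refine Matrix.IsSymm.add Z.2.1 (Matrix.IsSymm.smul ?_ _)
      ext i j
      simp [genericMatrix, pairIndex_comm]
    · convert Z.2.2 using 1
      ext i j
      simp⟩

/-- The factor by which `expTrace T` changes under translation by `genericMatrix n`. -/
noncomputable def genericPhase {n : ℕ} (T : Matrix (Fin n) (Fin n) ℤ) : ℂ :=
  Complex.exp (((Real.pi * (T.map (Int.cast : ℤ → ℝ) * genericMatrix n).trace : ℝ) : ℂ) * I)

theorem norm_genericPhase {n : ℕ} (T : Matrix (Fin n) (Fin n) ℤ) : ‖genericPhase T‖ = 1 :=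
  Complex.norm_exp_ofReal_mul_I _

theorem expTrace_genericShift {n : ℕ} (T : Matrix (Fin n) (Fin n) ℤ) (Z : SiegelSpace n) (m : ℕ) :
    expTrace T (genericShift Z m) = expTrace T Z * genericPhase T ^ m := by
  rw [expTrace, expTrace, genericPhase, ← Complex.exp_nat_mul, ← Complex.exp_add]
  congr 1
  simp only [genericShift, Matrix.mul_add, Matrix.trace_add, Matrix.mul_smul, Matrix.trace_smul,
    smul_eq_mul]
  have : (T.map (Int.cast : ℤ → ℂ) * (genericMatrix n).map ofReal).trace =
      (((T.map (Int.cast : ℤ → ℝ) * genericMatrix n).trace : ℝ) : ℂ) := by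
    simp [Matrix.trace, Matrix.mul_apply]
  rw [this]
  push_cast
  ring

theorem genericPhase_inj {n : ℕ} {T T' : Matrix (Fin n) (Fin n) ℤ} (hT : T.IsSymm)
    (hT' : T'.IsSymm) (h : genericPhase T = genericPhase T') : T = T' := by
  obtain ⟨k, hk⟩ := Complex.exp_eq_exp_iff_exists_int.1 h
  rw [← sub_eq_zero]
  -- The phase is `exp(πi ·)`, so equality of phases determines the trace modulo 2.
  refine eq_zero_of_trace_mul_genericMatrix (k := 2 * k) (hT.sub hT') ?_
  have h1 : (T - T').map (Int.cast : ℤ → ℝ) = T.map Int.cast - T'.map Int.cast := by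
    ext i j; simp
  rw [h1, Matrix.sub_mul, Matrix.trace_sub]
  have h2 : ((Real.pi * (T.map (Int.cast : ℤ → ℝ) * genericMatrix n).trace : ℝ) : ℂ) =
      ((Real.pi * (T'.map (Int.cast : ℤ → ℝ) * genericMatrix n).trace + k * (2 * Real.pi) : ℝ) : ℂ) := by
    refine mul_right_cancel₀ I_ne_zero ?_
    rw [hk]
    push_cast
    ring
  have h3 := ofReal_injective h2
  refine mul_left_cancel₀ Real.pi_ne_zero ?_
  push_cast
  linarith

section Lattice

variable {L : Type*} [AddCommGroup L] {B : LinearMap.BilinForm ℤ L}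

theorem IsEvenUnimodular.gramMatrix_isSymm (h : IsEvenUnimodular B) {n : ℕ} (g : Fin n → L) :
    (gramMatrix B g).IsSymm := by
  ext i j
  exact h.symm _ _

/-- Translation by multiples of one generic real matrix multiplies the terms of different Gram
matrices by powers of different phases, so a single average extracts the Fourier coefficient at `T`.
-/
theorem IsEvenUnimodular.tendsto_average_theta (h : IsEvenUnimodular B) {n : ℕ}
    {T : Matrix (Fin n) (Fin n) ℤ} (hT : T.IsSymm) (Z : SiegelSpace n) :
    Tendsto (fun M : ℕ => (M : ℂ)⁻¹ * ∑ m ∈ Finset.range M,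
      theta n B (genericShift Z m) * (genericPhase T)⁻¹ ^ m) atTop
      (𝓝 (Nat.card {g : Fin n → L // gramMatrix B g = T} * expTrace T Z)) := by
  have h0 : genericPhase T ≠ 0 := Complex.exp_ne_zero _
  have h1 := tendsto_average_tsum (z := fun g => genericPhase (gramMatrix B g) * (genericPhase T)⁻¹)
    (h.summable_norm_expTrace Z) (fun g => by
      rw [norm_mul, norm_inv, norm_genericPhase, norm_genericPhase]; norm_num)
  have h2 : (∑' g : Fin n → L, if genericPhase (gramMatrix B g) * (genericPhase T)⁻¹ = 1 then
      expTrace (gramMatrix B g) Z else 0) =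
      Nat.card {g : Fin n → L // gramMatrix B g = T} * expTrace T Z := by
    have h3 : ∀ g : Fin n → L, (if genericPhase (gramMatrix B g) * (genericPhase T)⁻¹ = 1 then
        expTrace (gramMatrix B g) Z else 0) =
        Set.indicator {g : Fin n → L | gramMatrix B g = T} (fun _ => expTrace T Z) g := fun g => by
      rw [Set.indicator_apply]
      refine if_ctx_congr ?_ (fun hg => by rw [hg]) fun _ => rfl
      rw [mul_inv_eq_one₀ h0]
      exact ⟨genericPhase_inj (h.gramMatrix_isSymm g) hT, fun hg => by rw [hg]⟩
    rw [tsum_congr h3, ← tsum_subtype, tsum_const, nsmul_eq_mul]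
    rfl
  rw [h2] at h1
  refine h1.congr fun M => ?_
  congr 1
  refine Finset.sum_congr rfl fun m _ => ?_
  rw [theta, ← tsum_mul_right]
  refine tsum_congr fun g => ?_
  rw [expTrace_genericShift, mul_pow, mul_assoc]

/-- The Gram matrix of a tuple, as an integral symmetric matrix with even diagonal. -/
def IsEvenUnimodular.evenGram (h : IsEvenUnimodular B) {n : ℕ} (g : Fin n → L) : EvenMatrix n :=
  ⟨gramMatrix B g, h.gramMatrix_isSymm g, fun i => h.even (g i)⟩

theorem IsEvenUnimodular.hasSum_theta (h : IsEvenUnimodular B) {n : ℕ} (Z : SiegelSpace n) :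
    HasSum (fun T : EvenMatrix n =>
      (Nat.card {g : Fin n → L // gramMatrix B g = T.1} : ℂ) * expTrace T.1 Z) (theta n B Z) := by
  have h1 : HasSum (fun g : Fin n → L => expTrace (gramMatrix B g) Z) (theta n B Z) :=
    (h.summable_expTrace Z).hasSum
  rw [← (Equiv.sigmaFiberEquiv h.evenGram).hasSum_iff] at h1
  refine h1.sigma fun T => ?_
  have h3 : Summable fun g : {g : Fin n → L // h.evenGram g = T} => expTrace (gramMatrix B g.1) Z :=
    (h.summable_expTrace Z).subtype _
  have h4 : ∀ g : {g : Fin n → L // h.evenGram g = T}, expTrace (gramMatrix B g.1) Z =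
      expTrace T.1 Z := fun g => by
    rw [show gramMatrix B g.1 = T.1 from congrArg Subtype.val g.2]
  have h5 := h3.hasSum
  rw [tsum_congr h4, tsum_const, nsmul_eq_mul] at h5
  have h6 : Nat.card {g : Fin n → L // gramMatrix B g = T.1} =
      Nat.card {g : Fin n → L // h.evenGram g = T} :=
    Nat.card_congr (Equiv.subtypeEquivRight fun g =>
      ⟨fun hg => Subtype.ext hg, fun hg => congrArg Subtype.val hg⟩)
  rw [h6]
  exact h5

end Lattice

theorem sum_mul_card_eq_zero {σ : Type*} [Fintype σ] {L : σ → Type*} [∀ i, AddCommGroup (L i)]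
    {B : ∀ i, LinearMap.BilinForm ℤ (L i)} (hB : ∀ i, IsEvenUnimodular (B i)) {n : ℕ} {c : σ → ℂ}
    (hc : ∀ Z, ∑ i, c i * theta n (B i) Z = 0) (T : Matrix (Fin n) (Fin n) ℤ) :
    ∑ i, c i * (Nat.card {g : Fin n → L i // gramMatrix (B i) g = T} : ℂ) = 0 := by
  by_cases hT : T.IsSymm
  · have hZ : (Nonempty (SiegelSpace n)) := ⟨⟨I • 1, by
      refine ⟨?_, ?_⟩
      · ext i j
        simp [Matrix.one_apply, eq_comm]
      · convert Matrix.PosDef.one (n := Fin n) (R := ℝ) using 1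
        ext i j
        by_cases hij : i = j <;> simp [hij, Matrix.one_apply]⟩⟩
    obtain ⟨Z⟩ := hZ
    have h1 := tendsto_finsetSum Finset.univ fun i _ =>
      ((hB i).tendsto_average_theta hT Z).const_mul (c i)
    have h2 : ∀ M : ℕ, ∑ i, c i * ((M : ℂ)⁻¹ * ∑ m ∈ Finset.range M,
        theta n (B i) (genericShift Z m) * (genericPhase T)⁻¹ ^ m) = 0 := fun M => by
      have : ∀ i, c i * ((M : ℂ)⁻¹ * ∑ m ∈ Finset.range M,
          theta n (B i) (genericShift Z m) * (genericPhase T)⁻¹ ^ m) = (M : ℂ)⁻¹ *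
          ∑ m ∈ Finset.range M, (c i * theta n (B i) (genericShift Z m)) * (genericPhase T)⁻¹ ^ m := by
        intro i
        rw [mul_left_comm, Finset.mul_sum]
        simp only [mul_assoc]
      simp only [this]
      rw [← Finset.mul_sum, Finset.sum_comm]
      simp [← Finset.sum_mul, hc]
    simp only [h2] at h1
    have h3 := tendsto_nhds_unique h1 tendsto_const_nhds
    simp only [← mul_assoc, ← Finset.sum_mul] at h3
    exact (mul_eq_zero.1 h3).resolve_right (Complex.exp_ne_zero _)
  -- A matrix that is not symmetric is not a Gram matrix, so every count is zero.
  · refine Finset.sum_eq_zero fun i _ => ?_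
    have : IsEmpty {g : Fin n → L i // gramMatrix (B i) g = T} :=
      ⟨fun g => hT (g.2 ▸ (hB i).gramMatrix_isSymm g.1)⟩
    simp

/-! ### Linear relations between representation numbers -/

/-- The number of vectors of norm `2`. -/
noncomputable def rootCount {L : Type*} [AddCommGroup L] (B : LinearMap.BilinForm ℤ L) : ℕ :=
  Nat.card {x : L // B x x = 2}

/-- The number of tuples with Gram matrix `T`. -/
noncomputable def gramCount {L : Type*} [AddCommGroup L] (B : LinearMap.BilinForm ℤ L) {n : ℕ}
    (T : Matrix (Fin n) (Fin n) ℤ) : ℕ :=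
  Nat.card {g : Fin n → L // gramMatrix B g = T}

section Family

variable {σ : Type*} [Fintype σ] {L : σ → Type*} [∀ i, AddCommGroup (L i)]
  {B : ∀ i, LinearMap.BilinForm ℤ (L i)} {n : ℕ} {c : σ → ℂ}

/-- A finite set of tuples cut out by conditions on the Gram matrix is a finite union of fibres, so
linear relations between representation numbers carry over to its cardinality. -/
theorem sum_mul_card_mem_eq_zero
    (hc : ∀ T : Matrix (Fin n) (Fin n) ℤ, ∑ i, c i * (gramCount (B i) T : ℂ) = 0)
    (P : Set (Matrix (Fin n) (Fin n) ℤ)) (hP : ∀ i, {g | gramMatrix (B i) g ∈ P}.Finite) :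
    ∑ i, c i * (Nat.card {g : Fin n → L i // gramMatrix (B i) g ∈ P} : ℂ) = 0 := by
  classical
  let F : Finset (Matrix (Fin n) (Fin n) ℤ) :=
    Finset.univ.biUnion fun i => (hP i).toFinset.image (gramMatrix (B i))
  have h1 : ∀ i, Nat.card {g : Fin n → L i // gramMatrix (B i) g ∈ P} =
      ∑ T ∈ F with T ∈ P, gramCount (B i) T := fun i => by
    rw [show Nat.card {g : Fin n → L i // gramMatrix (B i) g ∈ P} = (hP i).toFinset.card from
      Nat.card_eq_card_finite_toFinset (hP i)]
    rw [Finset.card_eq_sum_card_fiberwise (f := gramMatrix (B i)) (t := F.filter (· ∈ P))]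
    · refine Finset.sum_congr rfl fun T hT => ?_
      rw [gramCount, ← Nat.card_eq_finsetCard]
      refine Nat.card_congr (Equiv.subtypeEquivRight fun g => ?_)
      simp only [Finset.mem_filter, Set.Finite.mem_toFinset, Set.mem_ofPred_eq]
      exact ⟨fun h => h.2, fun h => ⟨h ▸ (Finset.mem_filter.1 hT).2, h⟩⟩
    · intro g hg
      have hg' : gramMatrix (B i) g ∈ P := by simpa using hg
      simp only [Finset.coe_filter, Set.mem_ofPred_eq]
      refine ⟨Finset.mem_biUnion.2 ⟨i, Finset.mem_univ _, Finset.mem_image_of_mem _ (by simpa using hg')⟩, hg'⟩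
  simp only [h1, Nat.cast_sum, Finset.mul_sum]
  rw [Finset.sum_comm]
  exact Finset.sum_eq_zero fun T _ => hc T

/-- The Gram matrices of `a` roots, `b` tuples of type `S` and otherwise zero vectors form a family
in which the inner products between different blocks are free. The tuples are then chosen
independently and the count is a product. -/
theorem sum_mul_rootCount_pow_mul_gramCount_pow (hB : ∀ i, IsEvenUnimodular (B i))
    (hc : ∀ T : Matrix (Fin n) (Fin n) ℤ, ∑ i, c i * (gramCount (B i) T : ℂ) = 0)
    {m : ℕ} {S : Matrix (Fin m) (Fin m) ℤ} (hS : ∀ p, S p p = 2) {a b : ℕ} (hab : a + b * m ≤ n) :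
    ∑ i, c i * ((rootCount (B i) : ℂ) ^ a * (gramCount (B i) S : ℂ) ^ b) = 0 := by
  classical
  obtain ⟨e⟩ : Nonempty ((Fin a ⊕ Fin b × Fin m) ↪ Fin n) :=
    Function.Embedding.nonempty_of_card_le (by simpa using hab)
  -- Positions outside the range of `e` have norm 0, which forces the vector there to be zero and
  -- pads the tuple to length `n`.
  let P : Set (Matrix (Fin n) (Fin n) ℤ) := {T | (∀ i, T (e (.inl i)) (e (.inl i)) = 2) ∧
    (∀ j p q, T (e (.inr (j, p))) (e (.inr (j, q))) = S p q) ∧ ∀ k ∉ Set.range e, T k k = 0}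
  have hfin : ∀ i, {g | gramMatrix (B i) g ∈ P}.Finite := fun i => by
    refine (Set.Finite.pi' fun _ => (hB i).finite_norm_le 2).subset fun g hg k => ?_
    obtain ⟨h1, h2, h3⟩ := hg
    by_cases hk : k ∈ Set.range e
    · obtain ⟨x | ⟨j, p⟩, rfl⟩ := hk
      · exact (h1 x).le
      · exact ((h2 j p p).trans (hS p)).le
    · exact (h3 k hk).le.trans (by norm_num)
  have hcard : ∀ i, Nat.card {g : Fin n → L i // gramMatrix (B i) g ∈ P} =
      rootCount (B i) ^ a * gramCount (B i) S ^ b := fun i => by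
    let f : {g : Fin n → L i // gramMatrix (B i) g ∈ P} ≃
        (Fin a → {x : L i // B i x x = 2}) × (Fin b → {g : Fin m → L i // gramMatrix (B i) g = S}) :=
      { toFun := fun g => (fun x => ⟨g.1 (e (.inl x)), g.2.1 x⟩,
          fun j => ⟨fun p => g.1 (e (.inr (j, p))), by ext p q; exact g.2.2.1 j p q⟩)
        invFun := fun u => ⟨Function.extend e
            (Sum.elim (fun x => (u.1 x).1) fun y => (u.2 y.1).1 y.2) 0, by
          refine ⟨fun x => ?_, fun j p q => ?_, fun k hk => ?_⟩
          · simp only [gramMatrix, Matrix.of_apply, e.injective.extend_apply, Sum.elim_inl]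
            exact (u.1 x).2
          · simp only [gramMatrix, Matrix.of_apply, e.injective.extend_apply, Sum.elim_inr]
            exact congrFun (congrFun (u.2 j).2 p) q
          · simp only [gramMatrix, Matrix.of_apply]
            rw [Function.extend_apply' _ _ _ hk]
            simp⟩
        left_inv := fun g => by
          ext k
          by_cases hk : k ∈ Set.range e
          · obtain ⟨x | ⟨j, p⟩, rfl⟩ := hk <;> simp [e.injective.extend_apply]
          · simp only
            rw [Function.extend_apply' _ _ _ hk]
            exact ((hB i).eq_zero (g.2.2.2 k hk)).symm
        right_inv := fun u => by
          ext x
          · simp [e.injective.extend_apply]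
          · simp [e.injective.extend_apply] }
    rw [Nat.card_congr f, Nat.card_prod, Nat.card_fun, Nat.card_fun, Nat.card_fin, Nat.card_fin]
    rfl
  have := sum_mul_card_mem_eq_zero hc P hfin
  simpa [hcard] using this

end Family

/-! ### Root systems of orthogonal sums -/

/-- The bilinear form of the root lattice of a Dynkin diagram. -/
def rootForm (d : Dynkin) : LinearMap.BilinForm ℤ (Fin d.rank → ℤ) :=
  Matrix.toBilin' d.cartan

/-- The matrix `T` is not the direct sum of two smaller matrices. -/
def IsConnectedGram {n : ℕ} (T : Matrix (Fin n) (Fin n) ℤ) : Prop :=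
  ∀ f : Fin n → ℕ, (∀ i j, T i j ≠ 0 → f i = f j) → ∀ i j, f i = f j

section Decomposition

variable {L : Type*} [AddCommGroup L] {B : LinearMap.BilinForm ℤ L} {m : ℕ}
  {M : Fin m → Type*} [∀ k, AddCommGroup (M k)] {β : ∀ k, LinearMap.BilinForm ℤ (M k)}

/-- The norm 2 is a sum of nonnegative even norms of orthogonal parts, so only one part is nonzero.
-/
theorem exists_component_of_root (h : IsEvenUnimodular B) (φ : ∀ k, M k →ₗ[ℤ] L)
    (hφ' : ∀ k l, k ≠ l → ∀ v w, B (φ k v) (φ l w) = 0)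
    (v : ∀ k, M k) (hv : B (∑ k, φ k (v k)) (∑ k, φ k (v k)) = 2) :
    ∃ k, ∑ l, φ l (v l) = φ k (v k) := by
  classical
  have hsum : B (∑ k, φ k (v k)) (∑ k, φ k (v k)) = ∑ k, B (φ k (v k)) (φ k (v k)) := by
    simp only [map_sum, LinearMap.sum_apply]
    refine Finset.sum_congr rfl fun k _ => ?_
    exact Finset.sum_eq_single k (fun l _ hl => hφ' l k hl _ _) (by simp)
  rw [hsum] at hv
  obtain ⟨k, -, hk⟩ : ∃ k ∈ Finset.univ, 0 < B (φ k (v k)) (φ k (v k)) :=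
    Finset.exists_lt_of_sum_lt (by simp [hv])
  refine ⟨k, Finset.sum_eq_single k (fun l _ hl => h.eq_zero ?_) (by simp)⟩
  have h2 : B (φ k (v k)) (φ k (v k)) + B (φ l (v l)) (φ l (v l)) ≤ 2 := by
    rw [← hv, ← Finset.sum_pair hl.symm (f := fun k => B (φ k (v k)) (φ k (v k)))]
    exact Finset.sum_le_sum_of_subset_of_nonneg (Finset.subset_univ _) fun j _ _ => h.nonneg _
  obtain ⟨x, hx⟩ := h.even (φ k (v k))
  obtain ⟨y, hy⟩ := h.even (φ l (v l))
  have := h.nonneg (φ l (v l))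
  omega

/-- Each root lies in one component, and roots in different components are orthogonal. The component
is therefore constant along the diagram of `T`, which is connected. -/
theorem gramCount_eq_sum_components (h : IsEvenUnimodular B) (φ : ∀ k, M k →ₗ[ℤ] L)
    (hφ : ∀ k v w, B (φ k v) (φ k w) = β k v w)
    (hφ' : ∀ k l, k ≠ l → ∀ v w, B (φ k v) (φ l w) = 0)
    (hpos : ∀ k v, v ≠ 0 → 0 < β k v v)
    (hspan : ∀ x, B x x = 2 → ∃ v : ∀ k, M k, x = ∑ k, φ k (v k))
    {n : ℕ} (hn : 0 < n) {T : Matrix (Fin n) (Fin n) ℤ} (hT : ∀ i, T i i = 2)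
    (hconn : IsConnectedGram T) :
    gramCount B T = ∑ k, gramCount (β k) T := by
  have hinj : ∀ k, Function.Injective (φ k) := fun k => by
    rw [injective_iff_map_eq_zero]
    intro v hv
    by_contra h0
    have := hpos k v h0
    rw [← hφ, hv] at this
    simp at this
  have hfin : Finite {g : Fin n → L // gramMatrix B g = T} := by
    refine Set.Finite.to_subtype ((Set.Finite.pi' fun _ => h.finite_norm_le 2).subset fun g hg k => ?_)
    exact ((congrFun (congrFun hg k) k).trans (hT k)).le
  let f : (Σ k, {g : Fin n → M k // gramMatrix (β k) g = T}) → {g : Fin n → L // gramMatrix B g = T} :=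
    fun g => ⟨fun i => φ g.1 (g.2.1 i), by
      refine Eq.trans ?_ g.2.2
      ext i j
      exact hφ _ _ _⟩
  have hf : Function.Injective f := by
    rintro ⟨k, g⟩ ⟨l, g'⟩ heq
    have h1 : ∀ i, φ k (g.1 i) = φ l (g'.1 i) := fun i => congrFun (Subtype.ext_iff.1 heq) i
    obtain rfl : k = l := by
      by_contra hkl
      have h2 := hφ' k l hkl (g.1 ⟨0, hn⟩) (g'.1 ⟨0, hn⟩)
      rw [← h1, hφ] at h2
      have h3 := (congrFun (congrFun g.2 ⟨0, hn⟩) ⟨0, hn⟩).trans (hT _)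
      simp only [gramMatrix, Matrix.of_apply] at h3
      omega
    congr 1
    ext i
    exact hinj k (h1 i)
  have hfin2 : ∀ k, Finite {g : Fin n → M k // gramMatrix (β k) g = T} := fun k =>
    Finite.of_injective (fun g => f ⟨k, g⟩) (hf.comp sigma_mk_injective)
  have hsurj : Function.Surjective f := by
    rintro ⟨g, hg⟩
    have hg' : ∀ i j, B (g i) (g j) = T i j := fun i j => congrFun (congrFun hg i) j
    have h1 : ∀ i, ∃ k, ∃ v : M k, g i = φ k v := fun i => by
      obtain ⟨v, hv⟩ := hspan (g i) ((hg' i i).trans (hT i))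
      obtain ⟨k, hk⟩ := exists_component_of_root h φ hφ' v (by rw [← hv, hg', hT])
      exact ⟨k, v k, hv.trans hk⟩
    choose k v hv using h1
    have h2 : ∀ i j, k i = k j := fun i j => by
      refine Fin.ext (hconn (fun i => (k i : ℕ)) (fun i j hij => ?_) i j)
      by_contra hne
      refine hij ?_
      rw [← hg', hv i, hv j]
      exact hφ' _ _ (fun h => hne (congrArg _ h)) _ _
    have h3 : ∀ i, ∃ w : M (k ⟨0, hn⟩), g i = φ _ w := fun i => by
      rw [← h2 i ⟨0, hn⟩]
      exact ⟨v i, hv i⟩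
    choose w hw using h3
    refine ⟨⟨k ⟨0, hn⟩, w, ?_⟩, ?_⟩
    · ext i j
      rw [← hg', hw i, hw j, hφ]
      rfl
    · refine Subtype.ext (funext fun i => (hw i).symm)
  rw [gramCount, ← Nat.card_congr (Equiv.ofBijective f ⟨hf, hsurj⟩), Nat.card_sigma]
  rfl

end Decomposition

/-- Since `T` has diagonal 2, only roots are counted, and these lie in the root lattice. Positivity
of the summands makes their maps to `L` injective. -/
theorem HasRootLattice.gramCount_eq {L : Type*} [AddCommGroup L] {B : LinearMap.BilinForm ℤ L}
    (h : IsEvenUnimodular B) {R : List Dynkin} (hR : HasRootLattice B R)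
    (hpos : ∀ d ∈ R, ∀ v, v ≠ 0 → 0 < rootForm d v v)
    {n : ℕ} (hn : 0 < n) {T : Matrix (Fin n) (Fin n) ℤ} (hT : ∀ i, T i i = 2)
    (hconn : IsConnectedGram T) :
    gramCount B T = (R.map fun d => gramCount (rootForm d) T).sum := by
  obtain ⟨b, hb, hspan⟩ := hR
  let φ : ∀ k : Fin R.length, (Fin (R.get k).rank → ℤ) →ₗ[ℤ] L := fun k =>
    Fintype.linearCombination ℤ fun i => b ⟨k, i⟩
  have hφB : ∀ k l v w, B (φ k v) (φ l w) = ∑ i, ∑ j, v i * w j * rootGram R ⟨k, i⟩ ⟨l, j⟩ := by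
    intro k l v w
    simp only [φ, Fintype.linearCombination_apply, map_sum, LinearMap.sum_apply, map_smul,
      LinearMap.smul_apply, smul_eq_mul, hb, Finset.mul_sum]
    rw [Finset.sum_comm]
    refine Finset.sum_congr rfl fun i _ => Finset.sum_congr rfl fun j _ => by ring
  have hφ : ∀ k v w, B (φ k v) (φ k w) = rootForm (R.get k) v w := fun k v w => by
    rw [hφB, rootForm, Matrix.toBilin'_apply]
    refine Finset.sum_congr rfl fun i _ => Finset.sum_congr rfl fun j _ => ?_
    rw [rootGram, Matrix.blockDiagonal'_apply_eq]
    ring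
  have hφ' : ∀ k l, k ≠ l → ∀ v w, B (φ k v) (φ l w) = 0 := fun k l hkl v w => by
    rw [hφB]
    refine Finset.sum_eq_zero fun i _ => Finset.sum_eq_zero fun j _ => ?_
    rw [rootGram, Matrix.blockDiagonal'_apply_ne _ _ _ hkl, mul_zero]
  rw [gramCount_eq_sum_components h φ hφ hφ' (fun k => hpos _ (List.get_mem _ _)) ?_ hn hT hconn,
    ← List.sum_ofFn]
  · congr 1
    conv_rhs => rw [← List.ofFn_get R, List.map_ofFn]
    rfl
  · intro x hx
    have h1 : x ∈ Submodule.span ℤ (Set.range b) := hspan ▸ Submodule.subset_span hx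
    obtain ⟨c, rfl⟩ := (Submodule.mem_span_range_iff_exists_fun ℤ).1 h1
    refine ⟨fun k i => c ⟨k, i⟩, ?_⟩
    rw [Fintype.sum_sigma]
    rfl

theorem rootCount_eq_gramCount {L : Type*} [AddCommGroup L] (B : LinearMap.BilinForm ℤ L) :
    rootCount B = gramCount B !![2] := by
  refine Nat.card_congr ⟨fun x => ⟨fun _ => x.1, ?_⟩, fun g => ⟨g.1 0, ?_⟩, fun x => rfl, fun g => ?_⟩
  · ext i j
    rw [Subsingleton.elim i 0, Subsingleton.elim j 0]
    exact x.2
  · exact congrFun (congrFun g.2 0) 0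
  · ext i
    rw [Subsingleton.elim i 0]

theorem HasRootLattice.rootCount_eq {L : Type*} [AddCommGroup L] {B : LinearMap.BilinForm ℤ L}
    (h : IsEvenUnimodular B) {R : List Dynkin} (hR : HasRootLattice B R)
    (hpos : ∀ d ∈ R, ∀ v, v ≠ 0 → 0 < rootForm d v v) :
    rootCount B = (R.map fun d => rootCount (rootForm d)).sum := by
  simp only [rootCount_eq_gramCount]
  refine hR.gramCount_eq h hpos one_pos (fun i => ?_) fun f _ i j => ?_
  · rw [Subsingleton.elim i 0]; rfl
  · rw [Subsingleton.elim i j]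

theorem isConnectedGram_D {n : ℕ} (hn : 3 ≤ n) : IsConnectedGram (CartanMatrix.D n) := by
  intro f hf
  suffices h : ∀ k (hk : k < n), f ⟨k, hk⟩ = f ⟨0, by omega⟩ from
    fun i j => (h i i.2).trans (h j j.2).symm
  intro k
  induction k using Nat.strong_induction_on with
  | _ k ih =>
    intro hk
    rcases Nat.eq_zero_or_pos k with rfl | hk0
    · rfl
    · by_cases hlast : k + 1 = n
      -- The last node is attached to the node two places before it; every other node is attached to
      -- its predecessor.
      · rw [← ih (k - 2) (by omega) (by omega)]
        refine hf _ _ ?_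
        simp only [CartanMatrix.D, Matrix.of_apply]
        grind
      · rw [← ih (k - 1) (by omega) (by omega)]
        refine hf _ _ ?_
        simp only [CartanMatrix.D, Matrix.of_apply]
        grind

/-! ### Euclidean models of root lattices -/

section Model

variable {r m : ℕ} {C : Matrix (Fin r) (Fin r) ℤ} {P : Matrix (Fin r) (Fin m) ℤ} {s : ℤ}

theorem vecMul_dotProduct_vecMul (hP : P * Pᵀ = s • C) (v w : Fin r → ℤ) :
    (v ᵥ* P) ⬝ᵥ (w ᵥ* P) = s * Matrix.toBilin' C v w := by
  rw [Matrix.toBilin'_apply', ← Matrix.dotProduct_mulVec, ← Matrix.mulVec_transpose,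
    Matrix.mulVec_mulVec, hP, Matrix.smul_mulVec, dotProduct_smul, smul_eq_mul]

theorem toBilin'_pos_of_model (hs : 0 < s) (hP : P * Pᵀ = s • C)
    (hinj : ∀ v, v ᵥ* P = 0 → v = 0) (v : Fin r → ℤ) (hv : v ≠ 0) :
    0 < Matrix.toBilin' C v v := by
  have h1 := vecMul_dotProduct_vecMul hP v v
  have h2 : 0 < (v ᵥ* P) ⬝ᵥ (v ᵥ* P) := by
    refine lt_of_le_of_ne (Finset.sum_nonneg fun i _ => mul_self_nonneg _) fun h => ?_
    exact hv (hinj v (dotProduct_self_eq_zero.1 h.symm))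
  rw [h1] at h2
  exact pos_of_mul_pos_right h2 hs.le

/-- The rows of `P` realise the basis inside `ℤᵐ` with the form scaled by `s`; the scale is 1 for
types `A` and `D`, and 4 for type `E`, whose coordinates are doubled. The set `S` has to describe
the lattice only on vectors of norm `2s`. -/
theorem exists_equiv_of_model (hs : 0 < s) (hP : P * Pᵀ = s • C)
    (hinj : ∀ v, v ᵥ* P = 0 → v = 0) (S : Set (Fin m → ℤ))
    (hS : ∀ x, x ⬝ᵥ x = 2 * s → (x ∈ S ↔ ∃ v, v ᵥ* P = x))
    {n : ℕ} {T : Matrix (Fin n) (Fin n) ℤ} (hT : ∀ i, T i i = 2) :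
    ∃ e : {g : Fin n → Fin r → ℤ // gramMatrix (Matrix.toBilin' C) g = T} ≃
      {g : Fin n → Fin m → ℤ // (∀ i, g i ∈ S) ∧ ∀ i j, g i ⬝ᵥ g j = s * T i j},
      ∀ g i, (e g).1 i = g.1 i ᵥ* P := by
  have key : ∀ g : Fin n → Fin r → ℤ, gramMatrix (Matrix.toBilin' C) g = T →
      ∀ i j, (g i ᵥ* P) ⬝ᵥ (g j ᵥ* P) = s * T i j := fun g hg i j => by
    rw [vecMul_dotProduct_vecMul hP, ← hg]
    rfl
  refine ⟨Equiv.ofBijective (fun g => ⟨fun i => g.1 i ᵥ* P, fun i => ?_, key g.1 g.2⟩)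
    ⟨fun g g' h => ?_, fun g => ?_⟩, fun g i => rfl⟩
  · refine (hS _ ?_).2 ⟨_, rfl⟩
    rw [key g.1 g.2, hT, mul_comm]
  · ext i : 2
    have h1 : g.1 i ᵥ* P = g'.1 i ᵥ* P := congrFun (Subtype.ext_iff.1 h) i
    exact sub_eq_zero.1 (hinj _ (by rw [Matrix.sub_vecMul, h1, sub_self]))
  · obtain ⟨g, hg, hgT⟩ := g
    choose v hv using fun i => (hS (g i) (by rw [hgT, hT, mul_comm])).1 (hg i)
    refine ⟨⟨v, ?_⟩, Subtype.ext (funext hv)⟩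
    ext i j
    have h1 := vecMul_dotProduct_vecMul hP (v i) (v j)
    rw [hv, hv, hgT] at h1
    exact (mul_left_cancel₀ hs.ne' h1).symm

theorem gramCount_eq_card_of_model (hs : 0 < s) (hP : P * Pᵀ = s • C)
    (hinj : ∀ v, v ᵥ* P = 0 → v = 0) (S : Set (Fin m → ℤ))
    (hS : ∀ x, x ⬝ᵥ x = 2 * s → (x ∈ S ↔ ∃ v, v ᵥ* P = x))
    {n : ℕ} {T : Matrix (Fin n) (Fin n) ℤ} (hT : ∀ i, T i i = 2) :
    gramCount (Matrix.toBilin' C) T =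
      Nat.card {g : Fin n → Fin m → ℤ // (∀ i, g i ∈ S) ∧ ∀ i j, g i ⬝ᵥ g j = s * T i j} :=
  have ⟨e, _⟩ := exists_equiv_of_model hs hP hinj S hS hT
  Nat.card_congr e

end Model

/-! ### Short vectors of the standard lattice -/

section Short

variable {m : ℕ}

theorem eq_single_of_dotProduct_self_eq_one {x : Fin m → ℤ} (hx : x ⬝ᵥ x = 1) :
    ∃ (j : Fin m) (u : ℤˣ), x = Pi.single j (u : ℤ) := by
  obtain ⟨j, hj⟩ : ∃ j, x j ≠ 0 := by
    by_contra! h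
    simp [funext h] at hx
  have h1 : x ⬝ᵥ x = x j * x j + ∑ i ∈ Finset.univ.erase j, x i * x i :=
    (Finset.add_sum_erase _ _ (Finset.mem_univ j)).symm
  have h2 : 0 < x j * x j := mul_self_pos.2 hj
  have h3 : 0 ≤ ∑ i ∈ Finset.univ.erase j, x i * x i :=
    Finset.sum_nonneg fun i _ => mul_self_nonneg _
  have h4 : ∑ i ∈ Finset.univ.erase j, x i * x i = 0 := by omega
  have h5 : x j * x j = 1 := by omega
  refine ⟨j, ⟨x j, x j, h5, h5⟩, ?_⟩
  ext i
  by_cases hij : i = j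
  · subst hij; simp
  · rw [Pi.single_eq_of_ne hij]
    have := (Finset.sum_eq_zero_iff_of_nonneg fun i _ => mul_self_nonneg _).1 h4 i (by simp [hij])
    exact mul_self_eq_zero.1 this

theorem exists_single_add_single_of_dotProduct_self_eq_two {x : Fin m → ℤ} (hx : x ⬝ᵥ x = 2) :
    ∃ (i j : Fin m) (u v : ℤˣ), i ≠ j ∧ x = Pi.single i (u : ℤ) + Pi.single j (v : ℤ) := by
  obtain ⟨i, hi⟩ : ∃ i, x i ≠ 0 := by
    by_contra! h
    simp [funext h] at hx
  have h0 : x i * x i ≤ 2 := by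
    rw [← hx]
    exact Finset.single_le_sum (f := fun i => x i * x i) (fun i _ => mul_self_nonneg _)
      (Finset.mem_univ i)
  have h1 : x i * x i = 1 := by
    have : x i ≤ 1 := by nlinarith
    have : -1 ≤ x i := by nlinarith
    have : x i = 1 ∨ x i = -1 := by omega
    rcases this with h | h <;> rw [h] <;> rfl
  have h2 : (x - Pi.single i (x i)) ⬝ᵥ (x - Pi.single i (x i)) = 1 := by
    simp only [sub_dotProduct, dotProduct_sub, single_dotProduct, dotProduct_single, hx,
      Pi.sub_apply, Pi.single_eq_same, sub_self, zero_mul]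
    omega
  obtain ⟨j, v, hj⟩ := eq_single_of_dotProduct_self_eq_one h2
  refine ⟨i, j, ⟨x i, x i, h1, h1⟩, v, ?_, ?_⟩
  · rintro rfl
    have := congrFun hj i
    simp at this
    exact v.ne_zero this.symm
  · rw [← hj]
    simp

theorem even_sum_of_even_dotProduct_self {x : Fin m → ℤ} (hx : Even (x ⬝ᵥ x)) : Even (∑ i, x i) := by
  have h : Even (x ⬝ᵥ x + ∑ i, x i) := by
    rw [dotProduct, ← Finset.sum_add_distrib]
    refine Finset.even_sum _ fun i _ => ?_
    have := Int.even_mul_succ_self (x i)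
    rwa [mul_add, mul_one] at this
  exact (Int.even_add.1 h).1 hx

/-- Two of three pairwise orthogonal vectors of norm `2`, all at angle `120` degrees to a fourth
one, have a sum that is twice a vector of norm `1`. -/
theorem exists_add_eq_two_smul {c : Fin m → ℤ} {l : Fin 3 → Fin m → ℤ} (hc : c ⬝ᵥ c = 2)
    (hl : ∀ i j, l i ⬝ᵥ l j = if i = j then 2 else 0) (hlc : ∀ i, l i ⬝ᵥ c = -1) :
    ∃ i j α, i ≠ j ∧ α ⬝ᵥ α = 1 ∧ l i + l j = (2 : ℤ) • α := by
  obtain ⟨i, j, u, v, hij, rfl⟩ := exists_single_add_single_of_dotProduct_self_eq_two hc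
  -- If two leaves both have product -1 with the same unit vector `ε`, then `l p + l q + 2ε` has
  -- norm 2 + 2 + 4 - 4 - 4 = 0.
  have key : ∀ (a : Fin m) (w : ℤˣ) (p q : Fin 3), p ≠ q →
      l p ⬝ᵥ Pi.single a (w : ℤ) = -1 → l q ⬝ᵥ Pi.single a (w : ℤ) = -1 →
      ∃ i j α, i ≠ j ∧ α ⬝ᵥ α = 1 ∧ l i + l j = (2 : ℤ) • α := by
    intro a w p q hpq hp hq
    have hw : (Pi.single a (w : ℤ) : Fin m → ℤ) ⬝ᵥ Pi.single a (w : ℤ) = 1 := by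
      simp
    refine ⟨p, q, -Pi.single a (w : ℤ), hpq, by simp, ?_⟩
    have h1 : (l p + l q + (2 : ℤ) • (Pi.single a (w : ℤ) : Fin m → ℤ)) ⬝ᵥ
        (l p + l q + (2 : ℤ) • (Pi.single a (w : ℤ) : Fin m → ℤ)) = 0 := by
      have h2 := dotProduct_comm (Pi.single a (w : ℤ)) (l p)
      have h3 := dotProduct_comm (Pi.single a (w : ℤ)) (l q)
      simp only [add_dotProduct, dotProduct_add, smul_dotProduct, dotProduct_smul, hl, hpq,
        hpq.symm, if_true, if_false, h2, h3, hp, hq, hw]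
      norm_num
    have h2 := dotProduct_self_eq_zero.1 h1
    rw [smul_neg]
    exact eq_neg_of_add_eq_zero_left h2
  have hle : ∀ (p : Fin 3) (a : Fin m) (w : ℤˣ), -1 ≤ l p ⬝ᵥ Pi.single a (w : ℤ) := by
    intro p a w
    have h0 : l p a * l p a ≤ 2 := by
      have := hl p p
      rw [if_pos rfl] at this
      rw [← this]
      exact Finset.single_le_sum (f := fun i => l p i * l p i) (fun i _ => mul_self_nonneg _)
        (Finset.mem_univ a)
    rw [dotProduct_single]
    have : l p a ≤ 1 := by nlinarith
    have : -1 ≤ l p a := by nlinarith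
    rcases Int.units_eq_one_or w with rfl | rfl <;> simp <;> omega
  -- The products of a leaf with the two unit summands of `c` lie in `{-1, 0, 1}` and add up to -1.
  have hlt : ∀ p, l p ⬝ᵥ Pi.single i (u : ℤ) = -1 ∨ l p ⬝ᵥ Pi.single j (v : ℤ) = -1 := by
    intro p
    have h1 := hlc p
    rw [dotProduct_add] at h1
    have h2 := hle p i u
    have h3 := hle p j v
    have h4 := hle p i (-u)
    have h5 := hle p j (-v)
    simp only [Units.val_neg, Pi.single_neg, dotProduct_neg] at h4 h5
    omega
  -- Pigeonhole: three leaves are distributed among two unit vectors.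
  rcases hlt 0 with h0 | h0 <;> rcases hlt 1 with h1 | h1 <;> rcases hlt 2 with h2 | h2
  · exact key _ _ 0 1 (by decide) h0 h1
  · exact key _ _ 0 1 (by decide) h0 h1
  · exact key _ _ 0 2 (by decide) h0 h2
  · exact key _ _ 1 2 (by decide) h1 h2
  · exact key _ _ 1 2 (by decide) h1 h2
  · exact key _ _ 0 2 (by decide) h0 h2
  · exact key _ _ 0 1 (by decide) h0 h1
  · exact key _ _ 0 1 (by decide) h0 h1

/-- The number of orthonormal `k`-tuples in the standard lattice. -/
theorem card_orthonormal (k m : ℕ) :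
    Nat.card {E : Fin k → Fin m → ℤ // ∀ i j, E i ⬝ᵥ E j = if i = j then 1 else 0} =
      2 ^ k * m.descFactorial k := by
  let f : (Fin k → ℤˣ) × (Fin k ↪ Fin m) →
      {E : Fin k → Fin m → ℤ // ∀ i j, E i ⬝ᵥ E j = if i = j then 1 else 0} :=
    fun p => ⟨fun i => Pi.single (p.2 i) (p.1 i : ℤ), fun i j => by
      by_cases hij : i = j
      · subst hij; simp
      · simp [hij]⟩
  have hf : Function.Bijective f := by
    refine ⟨fun p q hpq => ?_, fun E => ?_⟩
    · have h1 : ∀ i, (Pi.single (p.2 i) (p.1 i : ℤ) : Fin m → ℤ) = Pi.single (q.2 i) (q.1 i : ℤ) :=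
        fun i => congrFun (Subtype.ext_iff.1 hpq) i
      have h2 : ∀ i, p.2 i = q.2 i := fun i => by
        by_contra hne
        have := congrFun (h1 i) (p.2 i)
        rw [Pi.single_eq_same, Pi.single_eq_of_ne hne] at this
        exact (p.1 i).ne_zero this
      refine Prod.ext (funext fun i => Units.ext ?_) (Function.Embedding.ext h2)
      have := congrFun (h1 i) (p.2 i)
      rwa [Pi.single_eq_same, h2 i, Pi.single_eq_same] at this
    · obtain ⟨E, hE⟩ := E
      choose a u hau using fun i => eq_single_of_dotProduct_self_eq_one ((hE i i).trans (if_pos rfl))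
      refine ⟨⟨u, a, fun i j hij => ?_⟩, Subtype.ext (funext fun i => (hau i).symm)⟩
      by_contra hne
      have h1 := hE i j
      rw [hau i, hau j, hij, if_neg hne] at h1
      simp at h1
  rw [← Nat.card_congr (Equiv.ofBijective f hf), Nat.card_prod, Nat.card_eq_fintype_card,
    Nat.card_eq_fintype_card, Fintype.card_embedding_eq, Fintype.card_fun]
  simp [Fintype.card_units_int]

end Short

/-! ### Root lattices of type `A` -/

/-- The rows are the simple roots of type `A`. -/
def simpleRootsA (n : ℕ) : Matrix (Fin n) (Fin (n + 1)) ℤ :=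
  Matrix.of fun i => Pi.single i.castSucc 1 - Pi.single i.succ 1

theorem simpleRootsA_mulVec (n : ℕ) (x : Fin (n + 1) → ℤ) (i : Fin n) :
    (simpleRootsA n *ᵥ x) i = x i.castSucc - x i.succ := by
  have h : simpleRootsA n i = Pi.single i.castSucc 1 - Pi.single i.succ 1 := rfl
  rw [mulVec, show (fun j => simpleRootsA n i j) = _ from h, sub_dotProduct, single_one_dotProduct,
    single_one_dotProduct]

theorem simpleRootsA_mul_transpose (n : ℕ) :
    simpleRootsA n * (simpleRootsA n)ᵀ = (1 : ℤ) • CartanMatrix.A n := by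
  ext i j
  rw [one_smul]
  have h := simpleRootsA_mulVec n (simpleRootsA n j) i
  have h' : (simpleRootsA n * (simpleRootsA n)ᵀ) i j = (simpleRootsA n *ᵥ simpleRootsA n j) i := rfl
  rw [h', h]
  simp only [simpleRootsA, Matrix.of_apply, Pi.sub_apply, Pi.single_apply, CartanMatrix.A,
    Fin.ext_iff, Fin.val_castSucc, Fin.val_succ]
  grind

theorem vecMul_simpleRootsA_injective (n : ℕ) (v : Fin n → ℤ) (hv : v ᵥ* simpleRootsA n = 0) :
    v = 0 := by
  -- The 0/1 matrix of partial sums is a right inverse of the matrix of simple roots.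
  have hQ : simpleRootsA n * (Matrix.of fun (i : Fin (n + 1)) (j : Fin n) =>
      if i.1 ≤ j.1 then (1 : ℤ) else 0) = 1 := by
    ext i j
    have h' : (simpleRootsA n * (Matrix.of fun (i : Fin (n + 1)) (j : Fin n) =>
      if i.1 ≤ j.1 then (1 : ℤ) else 0)) i j = (simpleRootsA n *ᵥ fun i : Fin (n + 1) =>
      if i.1 ≤ j.1 then (1 : ℤ) else 0) i := rfl
    rw [h', simpleRootsA_mulVec, Matrix.one_apply]
    simp only [Fin.ext_iff, Fin.val_castSucc, Fin.val_succ]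
    grind
  rw [← Matrix.vecMul_one v, ← hQ, ← Matrix.vecMul_vecMul, hv, Matrix.zero_vecMul]

theorem sum_vecMul_simpleRootsA (n : ℕ) (v : Fin n → ℤ) : ∑ i, (v ᵥ* simpleRootsA n) i = 0 := by
  have h1 : ∑ i, (v ᵥ* simpleRootsA n) i = (v ᵥ* simpleRootsA n) ⬝ᵥ 1 := (dotProduct_one _).symm
  rw [h1, ← Matrix.dotProduct_mulVec]
  refine Finset.sum_eq_zero fun i _ => ?_
  rw [simpleRootsA_mulVec]
  simp

theorem exists_vecMul_simpleRootsA (n : ℕ) (a b : Fin (n + 1)) :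
    ∃ v, v ᵥ* simpleRootsA n = Pi.single a 1 - Pi.single b 1 := by
  have h : ∀ a : Fin (n + 1), ∃ v, v ᵥ* simpleRootsA n = Pi.single 0 1 - Pi.single a 1 := by
    intro a
    induction a using Fin.induction with
    | zero => exact ⟨0, by simp⟩
    | succ i ih =>
      obtain ⟨v, hv⟩ := ih
      refine ⟨v + Pi.single i 1, ?_⟩
      rw [Matrix.add_vecMul, hv, Matrix.single_one_vecMul]
      rw [show (simpleRootsA n).row i = Pi.single i.castSucc 1 - Pi.single i.succ 1 from rfl]
      abel
  obtain ⟨v, hv⟩ := h a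
  obtain ⟨w, hw⟩ := h b
  refine ⟨w - v, ?_⟩
  rw [Matrix.sub_vecMul, hv, hw]
  abel

theorem exists_of_sum_eq_zero {m : ℕ} {x : Fin m → ℤ} (hx : x ⬝ᵥ x = 2) (h0 : ∑ i, x i = 0) :
    ∃ i j, i ≠ j ∧ x = Pi.single i 1 - Pi.single j 1 := by
  obtain ⟨i, j, u, v, hij, rfl⟩ := exists_single_add_single_of_dotProduct_self_eq_two hx
  have h1 : (u : ℤ) + v = 0 := by
    simpa [Finset.sum_add_distrib] using h0
  rcases Int.units_eq_one_or u with rfl | rfl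
  · refine ⟨i, j, hij, ?_⟩
    have : (v : ℤ) = -1 := by simpa using (eq_neg_of_add_eq_zero_right h1)
    rw [this, Pi.single_neg, Units.val_one, sub_eq_add_neg]
  · refine ⟨j, i, hij.symm, ?_⟩
    have : (v : ℤ) = 1 := by simpa using (eq_neg_of_add_eq_zero_right h1)
    rw [this, Units.val_neg, Pi.single_neg, Units.val_one]
    abel

theorem rootForm_A_pos (n : ℕ) (v) (hv : v ≠ 0) : 0 < rootForm (.A n) v v :=
  toBilin'_pos_of_model one_pos (simpleRootsA_mul_transpose n) (vecMul_simpleRootsA_injective n) v hv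

theorem gramCount_rootForm_A (n : ℕ) {k : ℕ} {T : Matrix (Fin k) (Fin k) ℤ} (hT : ∀ i, T i i = 2) :
    gramCount (rootForm (.A n)) T = Nat.card {g : Fin k → Fin (n + 1) → ℤ //
      (∀ i, g i ∈ {x : Fin (n + 1) → ℤ | ∑ i, x i = 0}) ∧ ∀ i j, g i ⬝ᵥ g j = 1 * T i j} := by
  refine gramCount_eq_card_of_model one_pos (simpleRootsA_mul_transpose n)
    (vecMul_simpleRootsA_injective n) _ (fun x hx => ⟨fun h => ?_, ?_⟩) hT
  · obtain ⟨i, j, -, rfl⟩ := exists_of_sum_eq_zero hx h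
    exact exists_vecMul_simpleRootsA n i j
  · rintro ⟨v, rfl⟩
    exact sum_vecMul_simpleRootsA n v

theorem rootCount_rootForm_A (n : ℕ) : rootCount (rootForm (.A n)) = (n + 1) * n := by
  rw [rootCount_eq_gramCount, gramCount_rootForm_A n (fun i => by fin_cases i; rfl)]
  let f : {p : Fin (n + 1) × Fin (n + 1) // p.1 ≠ p.2} → {g : Fin 1 → Fin (n + 1) → ℤ //
      (∀ i, g i ∈ {x : Fin (n + 1) → ℤ | ∑ i, x i = 0}) ∧
      ∀ i j, g i ⬝ᵥ g j = 1 * (!![2] : Matrix (Fin 1) (Fin 1) ℤ) i j} :=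
    fun p => ⟨fun _ => Pi.single p.1.1 1 - Pi.single p.1.2 1, fun i => by simp, fun i j => by
      fin_cases i; fin_cases j
      simp [dotProduct_sub, p.2, p.2.symm]⟩
  have hf : Function.Bijective f := by
    refine ⟨fun p q hpq => ?_, fun g => ?_⟩
    · have h1 : (Pi.single p.1.1 1 - Pi.single p.1.2 1 : Fin (n + 1) → ℤ) =
          Pi.single q.1.1 1 - Pi.single q.1.2 1 := congrFun (Subtype.ext_iff.1 hpq) 0
      have h2 := congrFun h1 p.1.1
      have h3 := congrFun h1 p.1.2
      have hp := p.2
      have hq := q.2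
      simp only [Pi.sub_apply, Pi.single_apply] at h2 h3
      refine Subtype.ext (Prod.ext ?_ ?_) <;> grind
    · obtain ⟨g, hg, hgT⟩ := g
      obtain ⟨i, j, hij, h⟩ := exists_of_sum_eq_zero (x := g 0) (by simpa using hgT 0 0) (hg 0)
      refine ⟨⟨(i, j), hij⟩, Subtype.ext (funext fun k => ?_)⟩
      rw [Subsingleton.elim k 0]
      exact h.symm
  rw [← Nat.card_congr (Equiv.ofBijective f hf), Nat.card_eq_fintype_card, Fintype.card_subtype]
  have : (Finset.univ.filter fun p : Fin (n + 1) × Fin (n + 1) => p.1 ≠ p.2) =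
      Finset.univ.offDiag := by ext; simp
  rw [this, Finset.offDiag_card, Finset.card_univ, Fintype.card_fin]
  rw [← Nat.mul_sub_one]
  rfl

/-- A Gram matrix that contains the Cartan matrix of type `D₄` at the center `c` and leaves `l`. -/
def ContainsD4 {k : ℕ} (T : Matrix (Fin k) (Fin k) ℤ) (c : Fin k) (l : Fin 3 → Fin k) : Prop :=
  T c c = 2 ∧ (∀ i j, T (l i) (l j) = if i = j then 2 else 0) ∧ ∀ i, T (l i) c = -1

/-- Two leaves of a `D₄` would add up to `±2e_a`. This vector has coordinate sum `±2`, while roots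
of type `A` have coordinate sum 0. -/
theorem gramCount_rootForm_A_eq_zero (n : ℕ) {k : ℕ} {T : Matrix (Fin k) (Fin k) ℤ}
    (hT : ∀ i, T i i = 2) {c : Fin k} {l : Fin 3 → Fin k} (h : ContainsD4 T c l) :
    gramCount (rootForm (.A n)) T = 0 := by
  rw [gramCount_rootForm_A n hT]
  refine @Nat.card_of_isEmpty _ ⟨fun g => ?_⟩
  obtain ⟨g, hg, hgT⟩ := g
  simp only [one_mul] at hgT
  obtain ⟨i, j, α, -, hα, hsum⟩ := exists_add_eq_two_smul (c := g c) (l := fun i => g (l i))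
    ((hgT _ _).trans h.1) (fun i j => (hgT _ _).trans (h.2.1 i j))
    fun i => (hgT _ _).trans (h.2.2 i)
  obtain ⟨a, u, rfl⟩ := eq_single_of_dotProduct_self_eq_one hα
  have h1 := congrArg (fun x : Fin (n + 1) → ℤ => ∑ i, x i) hsum
  have h2 : ∑ x, g (l i) x = 0 := hg (l i)
  have h3 : ∑ x, g (l j) x = 0 := hg (l j)
  simp [Finset.sum_add_distrib, h2, h3, ← Finset.mul_sum] at h1

/-! ### Root lattices of type `D` -/

/-- The rows are the simple roots of type `D`. -/
def simpleRootsD (n : ℕ) : Matrix (Fin n) (Fin n) ℤ :=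
  Matrix.of fun i j => if i.1 + 1 < n then (if j = i then 1 else if j.1 = i.1 + 1 then -1 else 0)
    else if j.1 + 2 = n ∨ j.1 + 1 = n then 1 else 0

/-- Twice the inverse of `simpleRootsD n`. -/
def simpleCorootsD (n : ℕ) : Matrix (Fin n) (Fin n) ℤ :=
  Matrix.of fun i j => if j.1 + 2 < n then (if i ≤ j then 2 else 0)
    else if j.1 + 2 = n ∧ i.1 + 1 = n then -1 else 1

theorem simpleRootsD_mulVec {n : ℕ} (hn : 2 ≤ n) (x : Fin n → ℤ) (i : Fin n) :
    (simpleRootsD n *ᵥ x) i = if h : i.1 + 1 < n then x i - x ⟨i.1 + 1, h⟩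
      else x ⟨n - 2, by omega⟩ + x ⟨n - 1, by omega⟩ := by
  split_ifs with h
  · have : simpleRootsD n i = Pi.single i 1 - Pi.single ⟨i.1 + 1, h⟩ 1 := by
      ext j
      simp only [simpleRootsD, Matrix.of_apply, h, if_true, Pi.sub_apply, Pi.single_apply, Fin.ext_iff]
      grind
    rw [mulVec, show (fun j => simpleRootsD n i j) = _ from this, sub_dotProduct,
      single_one_dotProduct, single_one_dotProduct]
  · have : simpleRootsD n i = Pi.single ⟨n - 2, by omega⟩ 1 + Pi.single ⟨n - 1, by omega⟩ 1 := by
      ext j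
      simp only [simpleRootsD, Matrix.of_apply, h, if_false, Pi.add_apply, Pi.single_apply, Fin.ext_iff]
      grind
    rw [mulVec, show (fun j => simpleRootsD n i j) = _ from this, add_dotProduct,
      single_one_dotProduct, single_one_dotProduct]

theorem simpleRootsD_mul_transpose {n : ℕ} (hn : 3 ≤ n) :
    simpleRootsD n * (simpleRootsD n)ᵀ = (1 : ℤ) • CartanMatrix.D n := by
  ext i j
  rw [one_smul]
  have h := simpleRootsD_mulVec (by omega) (simpleRootsD n j) i
  have h' : (simpleRootsD n * (simpleRootsD n)ᵀ) i j = (simpleRootsD n *ᵥ simpleRootsD n j) i := rfl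
  rw [h', h]
  simp only [simpleRootsD, Matrix.of_apply, CartanMatrix.D, Fin.ext_iff,
    show ¬ n ≤ 2 by omega, if_false]
  clear h h'
  have hi := i.2
  have hj := j.2
  by_cases hi' : i.1 + 1 < n <;> by_cases hj' : j.1 + 1 < n <;>
    simp only [hi', hj', dif_pos, if_true, dif_neg, if_false, not_false_eq_true] <;> grind

theorem simpleRootsD_mul_simpleCorootsD {n : ℕ} (hn : 2 ≤ n) :
    simpleRootsD n * simpleCorootsD n = (2 : ℤ) • 1 := by
  ext i j
  have h := simpleRootsD_mulVec hn (fun i => simpleCorootsD n i j) i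
  have h' : (simpleRootsD n * simpleCorootsD n) i j =
    (simpleRootsD n *ᵥ fun i => simpleCorootsD n i j) i := rfl
  rw [h', h]
  simp only [simpleCorootsD, Matrix.of_apply, Matrix.smul_apply, Matrix.one_apply, Fin.ext_iff,
    Fin.le_def, smul_eq_mul]
  grind

/-- The determinant of `P` is nonzero, so multiplying `P (QP - s) = 0` by the adjugate cancels `P`
over `ℤ`. -/
theorem Matrix.mul_comm_of_mul_eq_smul_one {n : ℕ} {P Q : Matrix (Fin n) (Fin n) ℤ} {s : ℤ}
    (hs : s ≠ 0) (h : P * Q = s • 1) : Q * P = s • 1 := by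
  have hdet : P.det ≠ 0 := by
    intro h0
    have h1 := congrArg Matrix.det h
    rw [Matrix.det_mul, h0, zero_mul, Matrix.det_smul, Matrix.det_one, mul_one] at h1
    exact pow_ne_zero _ hs h1.symm
  have h2 : P * (Q * P - s • 1) = 0 := by
    rw [Matrix.mul_sub, ← Matrix.mul_assoc, h, Matrix.smul_mul, Matrix.mul_smul,
      Matrix.one_mul, Matrix.mul_one, sub_self]
  have h3 : P.adjugate * (P * (Q * P - s • 1)) = 0 := by rw [h2, Matrix.mul_zero]
  rw [← Matrix.mul_assoc, Matrix.adjugate_mul, Matrix.smul_mul, Matrix.one_mul] at h3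
  exact sub_eq_zero.1 ((smul_eq_zero.1 h3).resolve_left hdet)

theorem simpleCorootsD_mul_simpleRootsD {n : ℕ} (hn : 2 ≤ n) :
    simpleCorootsD n * simpleRootsD n = (2 : ℤ) • 1 :=
  Matrix.mul_comm_of_mul_eq_smul_one two_ne_zero (simpleRootsD_mul_simpleCorootsD hn)

theorem vecMul_simpleRootsD_injective {n : ℕ} (hn : 2 ≤ n) (v : Fin n → ℤ)
    (hv : v ᵥ* simpleRootsD n = 0) : v = 0 := by
  have h1 : (2 : ℤ) • v = 0 := by
    rw [← Matrix.vecMul_one v, ← Matrix.vecMul_smul, ← simpleRootsD_mul_simpleCorootsD hn,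
      ← Matrix.vecMul_vecMul, hv, Matrix.zero_vecMul]
  exact (smul_eq_zero.1 h1).resolve_left two_ne_zero

theorem exists_vecMul_simpleRootsD {n : ℕ} (hn : 2 ≤ n) {x : Fin n → ℤ} (hx : Even (∑ i, x i)) :
    ∃ v, v ᵥ* simpleRootsD n = x := by
  have h1 : ∀ j, Even ((x ᵥ* simpleCorootsD n) j) := by
    intro j
    -- The entries of `simpleCorootsD` are odd in the last two columns and even elsewhere, so each
    -- coordinate is even or has the parity of `∑ x i`.
    have h2 : Even ((x ᵥ* simpleCorootsD n) j + (if j.1 + 2 < n then 0 else 1) * ∑ i, x i) := by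
      rw [Matrix.vecMul, dotProduct, Finset.mul_sum, ← Finset.sum_add_distrib]
      refine Finset.even_sum _ fun i _ => ?_
      simp only [simpleCorootsD, Matrix.of_apply]
      rw [mul_comm (x i), ← add_mul]
      refine Even.mul_right ?_ _
      split_ifs <;> decide
    exact (Int.even_add.1 h2).2 (hx.mul_left _)
  choose v hv using h1
  refine ⟨v, ?_⟩
  have h2 : (2 : ℤ) • v = x ᵥ* simpleCorootsD n := by
    ext j
    rw [hv]
    simp [two_mul]
  have h3 : (2 : ℤ) • (v ᵥ* simpleRootsD n) = (2 : ℤ) • x := by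
    rw [← Matrix.smul_vecMul, h2, Matrix.vecMul_vecMul, simpleCorootsD_mul_simpleRootsD hn,
      Matrix.vecMul_smul, Matrix.vecMul_one]
  exact smul_right_injective _ two_ne_zero h3

theorem rootForm_D_pos {n : ℕ} (hn : 3 ≤ n) (v) (hv : v ≠ 0) : 0 < rootForm (.D n) v v :=
  toBilin'_pos_of_model one_pos (simpleRootsD_mul_transpose hn)
    (vecMul_simpleRootsD_injective (n := n) (by omega)) v hv

/-- Every vector of norm 2 in `ℤⁿ` has even coordinate sum and so lies in `Dₙ`; no membership
condition is left. -/
theorem gramCount_rootForm_D {n : ℕ} (hn : 3 ≤ n) {k : ℕ} {T : Matrix (Fin k) (Fin k) ℤ}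
    (hT : ∀ i, T i i = 2) :
    gramCount (rootForm (.D n)) T =
      Nat.card {g : Fin k → Fin n → ℤ // ∀ i j, g i ⬝ᵥ g j = T i j} := by
  have h := gramCount_eq_card_of_model one_pos (s := 1) (C := CartanMatrix.D n)
    (simpleRootsD_mul_transpose hn)
    (vecMul_simpleRootsD_injective (by omega)) Set.univ (fun x hx => ⟨fun _ => ?_, fun _ => trivial⟩) hT
  · refine h.trans (Nat.card_congr (Equiv.subtypeEquivRight fun g => ?_))
    simp
  · refine exists_vecMul_simpleRootsD (by omega) (even_sum_of_even_dotProduct_self ?_)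
    rw [hx]
    decide

/-! ### Counting in root lattices of type `D` -/

theorem card_pairs_lt (n : ℕ) : Nat.card {p : Fin n × Fin n // p.1 < p.2} = n * (n - 1) / 2 := by
  let f : {p : Fin n × Fin n // p.1 < p.2} ≃ Σ i : Fin n, Finset.Ioi i :=
    { toFun := fun p => ⟨p.1.1, p.1.2, by simpa using p.2⟩
      invFun := fun q => ⟨(q.1, q.2.1), Finset.mem_Ioi.1 q.2.2⟩
      left_inv := fun p => rfl
      right_inv := fun q => rfl }
  rw [Nat.card_congr f, Nat.card_sigma]
  simp only [Nat.card_eq_fintype_card, Fintype.card_coe, Fin.card_Ioi]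
  rw [Fin.sum_univ_eq_sum_range (fun i => n - 1 - i) n, Finset.sum_range_reflect (fun i => i) n,
    Finset.sum_range_id]

theorem rootCount_rootForm_D {n : ℕ} (hn : 3 ≤ n) :
    rootCount (rootForm (.D n)) = 2 * (n * (n - 1)) := by
  rw [rootCount_eq_gramCount, gramCount_rootForm_D hn (fun i => by fin_cases i; rfl)]
  let f : {p : Fin n × Fin n // p.1 < p.2} × ℤˣ × ℤˣ → {g : Fin 1 → Fin n → ℤ //
      ∀ i j, g i ⬝ᵥ g j = (!![2] : Matrix (Fin 1) (Fin 1) ℤ) i j} :=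
    fun p => ⟨fun _ => Pi.single p.1.1.1 (p.2.1 : ℤ) + Pi.single p.1.1.2 (p.2.2 : ℤ), fun i j => by
      fin_cases i; fin_cases j
      simp [dotProduct_add, p.1.2.ne, p.1.2.ne']⟩
  have hf : Function.Bijective f := by
    refine ⟨?_, fun g => ?_⟩
    · rintro ⟨⟨⟨i, j⟩, hij⟩, u, v⟩ ⟨⟨⟨i', j'⟩, hij'⟩, u', v'⟩ hpq
      have h1 : (Pi.single i (u : ℤ) + Pi.single j (v : ℤ) : Fin n → ℤ) =
          Pi.single i' (u' : ℤ) + Pi.single j' (v' : ℤ) := congrFun (Subtype.ext_iff.1 hpq) 0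
      have hu := u.ne_zero
      have hv := v.ne_zero
      simp only at hij hij'
      have h2 := congrFun h1 i
      have h3 := congrFun h1 j
      have h2' := congrFun h1 i'
      have h3' := congrFun h1 j'
      simp only [Pi.add_apply, Pi.single_apply] at h2 h3 h2' h3'
      have hi : i = i' := by grind
      have hj : j = j' := by grind
      subst hi hj
      have hu' : u = u' := Units.ext (by grind)
      have hv' : v = v' := Units.ext (by grind)
      rw [hu', hv']
    · obtain ⟨g, hg⟩ := g
      obtain ⟨i, j, u, v, hij, h⟩ :=
        exists_single_add_single_of_dotProduct_self_eq_two (x := g 0) (by simpa using hg 0 0)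
      rcases hij.lt_or_gt with hlt | hlt
      · refine ⟨⟨⟨(i, j), hlt⟩, u, v⟩, Subtype.ext (funext fun k => ?_)⟩
        rw [Subsingleton.elim k 0]
        exact h.symm
      · refine ⟨⟨⟨(j, i), hlt⟩, v, u⟩, Subtype.ext (funext fun k => ?_)⟩
        rw [Subsingleton.elim k 0]
        exact (h.trans (add_comm _ _)).symm
  rw [← Nat.card_congr (Equiv.ofBijective f hf), Nat.card_prod, Nat.card_prod, card_pairs_lt,
    Nat.card_eq_fintype_card, Fintype.card_units_int]
  have := Nat.div_mul_cancel (Nat.even_mul_pred_self n).two_dvd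
  omega

/-- Tuples of type `Dₖ` whose last two members are congruent modulo `2` come from orthonormal
tuples. -/
theorem card_fork {k : ℕ} (hk : 3 ≤ k) (m : ℕ) :
    Nat.card {g : Fin k → Fin m → ℤ // (∀ i j, g i ⬝ᵥ g j = CartanMatrix.D k i j) ∧
      ∃ u : Fin m → ℤ, g ⟨k - 2, by omega⟩ + g ⟨k - 1, by omega⟩ = (2 : ℤ) • u} =
      2 ^ k * m.descFactorial k := by
  rw [← card_orthonormal k m]
  symm
  have hPQ := simpleRootsD_mul_simpleCorootsD (n := k) (by omega)
  have hQP := simpleCorootsD_mul_simpleRootsD (n := k) (by omega)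
  have hPP := simpleRootsD_mul_transpose hk
  rw [one_smul] at hPP
  have hrow : ∀ (E : Matrix (Fin k) (Fin m) ℤ) i, (simpleRootsD k * E) i =
      if h : i.1 + 1 < k then E i - E ⟨i.1 + 1, h⟩
      else E ⟨k - 2, by omega⟩ + E ⟨k - 1, by omega⟩ := fun E i => by
    ext a
    have := simpleRootsD_mulVec (n := k) (by omega) (fun i => E i a) i
    refine Eq.trans this ?_
    split_ifs <;> rfl
  let f : {E : Fin k → Fin m → ℤ // ∀ i j, E i ⬝ᵥ E j = if i = j then 1 else 0} →
      {g : Fin k → Fin m → ℤ // (∀ i j, g i ⬝ᵥ g j = CartanMatrix.D k i j) ∧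
      ∃ u : Fin m → ℤ, g ⟨k - 2, by omega⟩ + g ⟨k - 1, by omega⟩ = (2 : ℤ) • u} :=
    fun E => ⟨simpleRootsD k * (Matrix.of E.1), fun i j => by
      have hE : Matrix.of E.1 * (Matrix.of E.1)ᵀ = 1 := by
        ext i j
        exact (E.2 i j).trans (Matrix.one_apply).symm
      have h1 : (simpleRootsD k * Matrix.of E.1) * (simpleRootsD k * Matrix.of E.1)ᵀ =
          CartanMatrix.D k := by
        rw [Matrix.transpose_mul, Matrix.mul_assoc, ← Matrix.mul_assoc (Matrix.of E.1), hE,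
          Matrix.one_mul, hPP]
      exact congrFun (congrFun h1 i) j, ⟨E.1 ⟨k - 2, by omega⟩, by
      rw [hrow, hrow, dif_pos (show k - 2 + 1 < k by omega), dif_neg (show ¬ k - 1 + 1 < k by omega)]
      have : (⟨k - 2 + 1, by omega⟩ : Fin k) = ⟨k - 1, by omega⟩ := Fin.ext (by simp; omega)
      rw [this, two_smul]
      exact sub_add_add_cancel _ _ _⟩⟩
  refine Nat.card_congr (Equiv.ofBijective f ⟨fun E E' h => ?_, fun G => ?_⟩)
  · have h1 : simpleRootsD k * (Matrix.of E.1) = simpleRootsD k * (Matrix.of E'.1) :=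
      Subtype.ext_iff.1 h
    have h2 : (2 : ℤ) • Matrix.of E.1 = (2 : ℤ) • Matrix.of E'.1 := by
      have h3 := congrArg (simpleCorootsD k * ·) h1
      simpa only [← Matrix.mul_assoc, hQP, Matrix.smul_mul, Matrix.one_mul] using h3
    exact Subtype.ext (Matrix.of.injective (smul_right_injective _ two_ne_zero h2))
  · obtain ⟨G, hG, u, hu⟩ := G
    -- Modulo 2 each row of `simpleCorootsD k * G` is 0 or the sum of the last two vectors of `G`,
    -- which is `2u`. Halving this product gives the orthonormal tuple.
    have heven : ∀ i a, Even ((simpleCorootsD k * Matrix.of G) i a) := by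
      intro i a
      have h1 : ∑ j : Fin k, (if j.1 + 2 < k then 0 else 1) * G j a = 2 * u a := by
        have h2 : ∀ j : Fin k, (if j.1 + 2 < k then (0 : ℤ) else 1) =
            (Pi.single ⟨k - 2, by omega⟩ 1 + Pi.single ⟨k - 1, by omega⟩ 1 : Fin k → ℤ) j := by
          intro j
          have := j.2
          simp only [Pi.add_apply, Pi.single_apply, Fin.ext_iff]
          grind
        simp only [h2]
        have h3 := congrFun hu a
        simp only [Pi.add_apply, Pi.smul_apply, smul_eq_mul] at h3
        simp only [Pi.add_apply, add_mul, Finset.sum_add_distrib, Pi.single_apply, ite_mul, one_mul,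
          zero_mul, Finset.sum_ite_eq', Finset.mem_univ, if_true]
        exact h3
      have h4 : Even ((simpleCorootsD k * Matrix.of G) i a + 2 * u a) := by
        rw [← h1, Matrix.mul_apply, ← Finset.sum_add_distrib]
        refine Finset.even_sum _ fun j _ => ?_
        simp only [simpleCorootsD, Matrix.of_apply]
        rw [← add_mul]
        refine Even.mul_right ?_ _
        split_ifs <;> decide
      exact (Int.even_add.1 h4).2 (even_two_mul _)
    choose E hE using heven
    have h2E : (2 : ℤ) • Matrix.of E = simpleCorootsD k * Matrix.of G := by
      ext i a
      rw [hE, Matrix.smul_apply, smul_eq_mul, two_mul]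
      rfl
    have hGG : Matrix.of G * (Matrix.of G)ᵀ = simpleRootsD k * (simpleRootsD k)ᵀ := by
      rw [hPP]
      ext i j
      exact hG i j
    -- With `G Gᵀ = P Pᵀ` and `Q P = 2`, the Gram matrix of `2E = Q G` is `Q P (Q P)ᵀ = 4`.
    have hEE : (4 : ℤ) • (Matrix.of E * (Matrix.of E)ᵀ) = (4 : ℤ) • 1 := by
      have h1 : (4 : ℤ) • (Matrix.of E * (Matrix.of E)ᵀ) =
          ((2 : ℤ) • Matrix.of E) * ((2 : ℤ) • Matrix.of E)ᵀ := by
        rw [Matrix.transpose_smul, Matrix.smul_mul, Matrix.mul_smul, smul_smul]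
        norm_num
      rw [h1, h2E, Matrix.transpose_mul, Matrix.mul_assoc, ← Matrix.mul_assoc (Matrix.of G), hGG,
        Matrix.mul_assoc, ← Matrix.mul_assoc, hQP, ← Matrix.transpose_mul, hQP,
        Matrix.transpose_smul, Matrix.smul_mul, Matrix.mul_smul, smul_smul, Matrix.transpose_one,
        Matrix.one_mul]
      norm_num
    have hEE' := smul_right_injective _ (four_ne_zero' ℤ) hEE
    refine ⟨⟨E, fun i j => (congrFun (congrFun hEE' i) j).trans Matrix.one_apply⟩, Subtype.ext ?_⟩
    have h3 : (2 : ℤ) • (simpleRootsD k * Matrix.of E) = (2 : ℤ) • Matrix.of G := by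
      rw [← Matrix.mul_smul, h2E, ← Matrix.mul_assoc, hPQ, Matrix.smul_mul, Matrix.one_mul]
    exact smul_right_injective _ two_ne_zero h3

/-- The center of the branched end of the Dynkin diagram of type `D`, with its neighbours. -/
theorem containsD4_D {k : ℕ} (hk : 4 ≤ k) : ContainsD4 (CartanMatrix.D k) ⟨k - 3, by omega⟩
    ![⟨k - 4, by omega⟩, ⟨k - 2, by omega⟩, ⟨k - 1, by omega⟩] := by
  refine ⟨by simp, fun i j => ?_, fun i => ?_⟩
  · fin_cases i <;> fin_cases j <;> simp [CartanMatrix.D] <;> omega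
  · fin_cases i <;> simp [CartanMatrix.D] <;> omega

/-- Some two of the three neighbours of the branch node are congruent modulo 2. For `k ≥ 5` the node
`k - 5` has product -1 with the neighbour `k - 4` and 0 with the other two, so the congruent pair
must be the two fork ends. The condition in `card_fork` is therefore automatic. -/
theorem gramCount_rootForm_D_D {n k : ℕ} (hn : 3 ≤ n) (hk : 5 ≤ k) :
    gramCount (rootForm (.D n)) (CartanMatrix.D k) = 2 ^ k * n.descFactorial k := by
  rw [gramCount_rootForm_D hn (CartanMatrix.D_diag k), ← card_fork (by omega) n]
  refine Nat.card_congr (Equiv.subtypeEquivRight fun g => ⟨fun hg => ⟨hg, ?_⟩, fun hg => hg.1⟩)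
  have hD := containsD4_D (k := k) (by omega)
  obtain ⟨i, j, α, hij, -, hsum⟩ := exists_add_eq_two_smul (c := g ⟨k - 3, by omega⟩)
    (l := fun i => g (![⟨k - 4, by omega⟩, ⟨k - 2, by omega⟩, ⟨k - 1, by omega⟩] i))
    ((hg _ _).trans hD.1) (fun i j => (hg _ _).trans (hD.2.1 i j)) fun i => (hg _ _).trans (hD.2.2 i)
  have h0 : g ⟨k - 5, by omega⟩ ⬝ᵥ g ⟨k - 4, by omega⟩ = -1 := by
    rw [hg]; simp [CartanMatrix.D]; omega
  have h2 : g ⟨k - 5, by omega⟩ ⬝ᵥ g ⟨k - 2, by omega⟩ = 0 := by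
    rw [hg]; simp [CartanMatrix.D]; omega
  have h3 : g ⟨k - 5, by omega⟩ ⬝ᵥ g ⟨k - 1, by omega⟩ = 0 := by
    rw [hg]; simp [CartanMatrix.D]; omega
  -- The right side becomes even, which excludes every pair containing the neighbour `k - 4`.
  have hdot := congrArg (fun x => g ⟨k - 5, by omega⟩ ⬝ᵥ x) hsum
  simp only [dotProduct_add, dotProduct_smul, smul_eq_mul] at hdot
  fin_cases i <;> fin_cases j <;> simp [h0, h2, h3] at hdot hij hsum
  all_goals first | exact absurd hdot (by omega) | exact ⟨α, hsum⟩ | exact ⟨α, (add_comm _ _).trans hsum⟩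

/-- The cyclic rotations of the three leaves of the Dynkin diagram of type `D₄`. -/
def rotateD4 : Fin 3 → Fin 4 → Fin 4 := ![![0, 1, 2, 3], ![2, 1, 3, 0], ![3, 1, 0, 2]]

/-- If both sums were doubled vectors, `(x + y) ⬝ᵥ (y + z) = 2` would be divisible by 4. -/
theorem not_congruent_of_orthogonal {m : ℕ} {x y z u w : Fin m → ℤ} (hy : y ⬝ᵥ y = 2)
    (hxy : x ⬝ᵥ y = 0) (hyz : y ⬝ᵥ z = 0) (hxz : x ⬝ᵥ z = 0) (h1 : x + y = (2 : ℤ) • u)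
    (h2 : y + z = (2 : ℤ) • w) : False := by
  have h3 : (x + y) ⬝ᵥ (y + z) = 2 := by
    simp [add_dotProduct, dotProduct_add, hy, hxy, hyz, hxz]
  rw [h1, h2] at h3
  simp only [smul_dotProduct, dotProduct_smul, smul_eq_mul] at h3
  omega

/-- The diagram `D₄` has three equivalent leaves, of which exactly one pair is congruent modulo 2.
Rotating that pair to the last two positions yields the factor 3 over `card_fork`. -/
theorem gramCount_rootForm_D_D4 {n : ℕ} (hn : 3 ≤ n) :
    gramCount (rootForm (.D n)) (CartanMatrix.D 4) = 3 * (2 ^ 4 * n.descFactorial 4) := by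
  rw [gramCount_rootForm_D hn (CartanMatrix.D_diag 4), ← card_fork (k := 4) (by omega) n]
  have hrot : ∀ a i j, CartanMatrix.D 4 (rotateD4 a i) (rotateD4 a j) = CartanMatrix.D 4 i j := by
    intro a i j
    fin_cases a <;> fin_cases i <;> fin_cases j <;> rfl
  have hsurj : ∀ a i, ∃ j, rotateD4 a j = i := by decide
  let X := {g : Fin 4 → Fin n → ℤ // (∀ i j, g i ⬝ᵥ g j = CartanMatrix.D 4 i j) ∧
      ∃ u : Fin n → ℤ, g 2 + g 3 = (2 : ℤ) • u}
  let f : Fin 3 × X → {g : Fin 4 → Fin n → ℤ // ∀ i j, g i ⬝ᵥ g j = CartanMatrix.D 4 i j} :=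
    fun p => ⟨fun i => p.2.1 (rotateD4 p.1 i), fun i j => (p.2.2.1 _ _).trans (hrot _ _ _)⟩
  have hf : Function.Bijective f := by
    refine ⟨?_, fun g => ?_⟩
    · rintro ⟨a, g, hg, u, hu⟩ ⟨b, g', hg', u', hu'⟩ h
      have h1 : ∀ i, g (rotateD4 a i) = g' (rotateD4 b i) :=
        fun i => congrFun (Subtype.ext_iff.1 h) i
      have h02 : g 0 ⬝ᵥ g 2 = 0 := hg 0 2
      have h03 : g 0 ⬝ᵥ g 3 = 0 := hg 0 3
      have h23 : g 2 ⬝ᵥ g 3 = 0 := hg 2 3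
      have h20 : g 2 ⬝ᵥ g 0 = 0 := hg 2 0
      have h30 : g 3 ⬝ᵥ g 0 = 0 := hg 3 0
      have h32 : g 3 ⬝ᵥ g 2 = 0 := hg 3 2
      have h22 : g 2 ⬝ᵥ g 2 = 2 := hg 2 2
      have h33 : g 3 ⬝ᵥ g 3 = 2 := hg 3 3
      have hu2 : g 3 + g 2 = (2 : ℤ) • u := (add_comm _ _).trans hu
      have hcontra2 : ∀ v, g 0 + g 2 ≠ (2 : ℤ) • v := fun v hv =>
        not_congruent_of_orthogonal h22 h02 h23 h03 hv hu
      have hcontra3 : ∀ v, g 0 + g 3 ≠ (2 : ℤ) • v := fun v hv =>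
        not_congruent_of_orthogonal h33 h03 h32 h02 hv hu2
      have hab : a = b := by
        have e0 := h1 0
        have e2 := h1 2
        have e3 := h1 3
        fin_cases a <;> fin_cases b <;> simp [rotateD4] at e0 e2 e3 ⊢
        all_goals
          simp only [← e0, ← e2, ← e3] at hu'
          first
          | exact hcontra2 _ hu'
          | exact hcontra3 _ hu'
          | exact hcontra2 _ ((add_comm _ _).trans hu')
          | exact hcontra3 _ ((add_comm _ _).trans hu')
      subst hab
      have h2 : ∀ i, g i = g' i := fun i => by
        obtain ⟨j, rfl⟩ : ∃ j, rotateD4 a j = i := by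
          exact hsurj a i
        exact h1 j
      obtain rfl : g = g' := funext h2
      rfl
    · obtain ⟨g, hg⟩ := g
      have hD := containsD4_D (k := 4) le_rfl
      obtain ⟨i, j, α, hij, -, hsum⟩ := exists_add_eq_two_smul (c := g 1) (l := fun i => g (![0, 2, 3] i))
        ((hg _ _).trans hD.1) (fun i j => (hg _ _).trans (hD.2.1 i j))
        fun i => (hg _ _).trans (hD.2.2 i)
      -- Rotation 0 is the identity, and rotations 1 and 2 are inverse to each other. Rotation `b`
      -- brings the congruent pair into positions 2 and 3.
      have key : ∀ a b, (∀ i, rotateD4 b (rotateD4 a i) = i) →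
          g (rotateD4 b 2) + g (rotateD4 b 3) = (2 : ℤ) • α → ∃ p, f p = ⟨g, hg⟩ := by
        intro a b hab h
        refine ⟨(a, ⟨fun i => g (rotateD4 b i), fun i j => (hg _ _).trans (hrot _ _ _), α, h⟩),
          Subtype.ext (funext fun i => ?_)⟩
        exact congrArg g (hab i)
      have hsum' := (add_comm _ _).trans hsum
      fin_cases i <;> fin_cases j <;> simp at hij hsum hsum'
      all_goals
        first
        | exact key 0 0 (by decide) hsum
        | exact key 0 0 (by decide) hsum'
        | exact key 1 2 (by decide) hsum
        | exact key 1 2 (by decide) hsum'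
        | exact key 2 1 (by decide) hsum
        | exact key 2 1 (by decide) hsum'
  rw [← Nat.card_congr (Equiv.ofBijective f hf), Nat.card_prod, Nat.card_fin]
  rfl

/-! ### Reflections -/

section Reflection

variable {M : Type*} [AddCommGroup M] {β : LinearMap.BilinForm ℤ M}

/-- The reflection in a vector of norm `2`. -/
def rootReflection (β : LinearMap.BilinForm ℤ M) (r x : M) : M := x - β x r • r

theorem rootReflection_involutive {r : M} (hr : β r r = 2) :
    Function.Involutive (rootReflection β r) := by
  intro x
  simp only [rootReflection, map_sub, LinearMap.sub_apply, map_smul, LinearMap.smul_apply,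
    smul_eq_mul, hr]
  module

theorem apply_rootReflection (hβ : ∀ x y, β x y = β y x) {r : M} (hr : β r r = 2) (x y : M) :
    β (rootReflection β r x) (rootReflection β r y) = β x y := by
  simp only [rootReflection, map_sub, LinearMap.sub_apply, map_smul, LinearMap.smul_apply,
    smul_eq_mul, hr, hβ r y]
  ring

/-- Roots `x`, `y` with product 1 differ by a root, and the reflection in `x - y` interchanges them.
-/
theorem nonempty_equiv_of_adjacent (hβ : ∀ x y, β x y = β y x) {n : ℕ}
    (T : Matrix (Fin n) (Fin n) ℤ) (a : Fin n) {x y : M} (hx : β x x = 2) (hy : β y y = 2)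
    (hxy : β x y = 1) :
    Nonempty ({g : Fin n → M // gramMatrix β g = T ∧ g a = x} ≃
      {g : Fin n → M // gramMatrix β g = T ∧ g a = y}) := by
  have hyx : β y x = 1 := (hβ y x).trans hxy
  have hr : β (x - y) (x - y) = 2 := by simp [hx, hy, hxy, hyx]
  have hinv := rootReflection_involutive hr
  have hs : rootReflection β (x - y) x = y := by simp [rootReflection, hx, hxy]
  have hs' : rootReflection β (x - y) y = x := (congrArg _ hs.symm).trans (hinv x)
  have hgram : ∀ g : Fin n → M, gramMatrix β (fun i => rootReflection β (x - y) (g i)) =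
      gramMatrix β g := fun g => by
    ext i j
    exact apply_rootReflection hβ hr _ _
  exact ⟨{
    toFun := fun g => ⟨fun i => rootReflection β (x - y) (g.1 i), (hgram _).trans g.2.1,
      (congrArg _ g.2.2).trans hs⟩
    invFun := fun g => ⟨fun i => rootReflection β (x - y) (g.1 i), (hgram _).trans g.2.1,
      (congrArg _ g.2.2).trans hs'⟩
    left_inv := fun g => Subtype.ext (funext fun i => hinv _)
    right_inv := fun g => Subtype.ext (funext fun i => hinv _) }⟩

/-- Three reflections carry any root to `x₀`, so the number of tuples with a prescribed root at
position `a` does not depend on that root. -/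
theorem gramCount_eq_rootCount_mul (hβ : ∀ x y, β x y = β y x) {n : ℕ}
    {T : Matrix (Fin n) (Fin n) ℤ} {a : Fin n} (hT : T a a = 2) {x₀ : M} (hx₀ : β x₀ x₀ = 2)
    (htrans : ∀ x, β x x = 2 → ∃ y z, β y y = 2 ∧ β z z = 2 ∧ β x y = 1 ∧ β y z = 1 ∧ β z x₀ = 1) :
    gramCount β T = rootCount β * Nat.card {g : Fin n → M // gramMatrix β g = T ∧ g a = x₀} := by
  have hne : ∀ x : {x : M // β x x = 2}, Nonempty ({g : Fin n → M // gramMatrix β g = T ∧ g a = x.1} ≃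
      {g : Fin n → M // gramMatrix β g = T ∧ g a = x₀}) := fun x => by
    obtain ⟨y, z, hy, hz, hxy, hyz, hz0⟩ := htrans x.1 x.2
    obtain ⟨e₁⟩ := nonempty_equiv_of_adjacent hβ T a x.2 hy hxy
    obtain ⟨e₂⟩ := nonempty_equiv_of_adjacent hβ T a hy hz hyz
    obtain ⟨e₃⟩ := nonempty_equiv_of_adjacent hβ T a hz hx₀ hz0
    exact ⟨e₁.trans (e₂.trans e₃)⟩
  let f : {g : Fin n → M // gramMatrix β g = T} ≃
      Σ x : {x : M // β x x = 2}, {g : Fin n → M // gramMatrix β g = T ∧ g a = x.1} :=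
    { toFun := fun g => ⟨⟨g.1 a, (congrFun (congrFun g.2 a) a).trans hT⟩, g.1, g.2, rfl⟩
      invFun := fun p => ⟨p.2.1, p.2.2.1⟩
      left_inv := fun g => rfl
      right_inv := by
        rintro ⟨⟨x, hx⟩, ⟨g, hg, hga⟩⟩
        obtain rfl : g a = x := hga
        rfl }
  rw [gramCount, Nat.card_congr (f.trans ((Equiv.sigmaCongrRight fun x => (hne x).some).trans
    (Equiv.sigmaEquivProd _ _))), Nat.card_prod]
  rfl

end Reflection

/-! ### Lists of vectors -/

/-- The inner product of integral vectors that are given as lists. -/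
def dotList : List ℤ → List ℤ → ℤ
  | a :: l, b :: m => a * b + dotList l m
  | _, _ => 0

theorem dotList_ofFn {n : ℕ} (x y : Fin n → ℤ) :
    dotList (List.ofFn x) (List.ofFn y) = x ⬝ᵥ y := by
  induction n with
  | zero => simp [dotList]
  | succ n ih =>
    rw [List.ofFn_succ, List.ofFn_succ, dotList, ih]
    exact (Fin.sum_univ_succ fun i => x i * y i).symm

theorem dotList_self_nonneg (l : List ℤ) : 0 ≤ dotList l l := by
  induction l with
  | nil => exact le_rfl
  | cons a l ih => exact add_nonneg (mul_self_nonneg a) ih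

theorem eq_replicate_of_dotList_self_eq_zero {l : List ℤ} (h : dotList l l = 0) :
    l = List.replicate l.length 0 := by
  induction l with
  | nil => rfl
  | cons a l ih =>
    have h1 := dotList_self_nonneg l
    have h2 := mul_self_nonneg a
    rw [dotList] at h
    have h3 : a = 0 := mul_self_eq_zero.1 (by omega)
    rw [List.length_cons, List.replicate_succ, ← ih (by omega), h3]

theorem length_le_dotList_self {l : List ℤ} (h : ∀ a ∈ l, Odd a) : (l.length : ℤ) ≤ dotList l l := by
  induction l with
  | nil => exact le_rfl
  | cons a l ih =>
    have h1 := ih fun b hb => h b (List.mem_cons_of_mem _ hb)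
    have h2 : a ≠ 0 := by
      rintro rfl
      exact absurd (h 0 List.mem_cons_self) (by decide)
    have h3 := mul_self_pos.2 h2
    rw [dotList, List.length_cons]
    push_cast
    omega

/-- The vectors with all coordinates `±1`. -/
def signVectors : ℕ → List (List ℤ)
  | 0 => [[]]
  | n + 1 => (signVectors n).map (List.cons 1) ++ (signVectors n).map (List.cons (-1))

/-- The vectors with one coordinate `±2` and all others `0`. -/
def doubledUnits : ℕ → List (List ℤ)
  | 0 => []
  | n + 1 => [2 :: List.replicate n 0, -2 :: List.replicate n 0] ++
      (doubledUnits n).map (List.cons 0)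

/-- The vectors with two coordinates `±2` and all others `0`. -/
def doubledRootsD : ℕ → List (List ℤ)
  | 0 => []
  | n + 1 => (doubledUnits n).map (List.cons 2) ++ (doubledUnits n).map (List.cons (-2)) ++
      (doubledRootsD n).map (List.cons 0)

/-- Odd squares are at least 1, so equality of norm and length forces every coordinate to be `±1`.
-/
theorem mem_signVectors {l : List ℤ} (h : ∀ a ∈ l, Odd a) (hl : dotList l l = l.length) :
    l ∈ signVectors l.length := by
  induction l with
  | nil => simp [signVectors]
  | cons a l ih =>
    have h' : ∀ b ∈ l, Odd b := fun b hb => h b (List.mem_cons_of_mem _ hb)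
    have h1 := length_le_dotList_self h'
    have h2 : a ≠ 0 := by
      rintro rfl
      exact absurd (h 0 List.mem_cons_self) (by decide)
    have h3 := mul_self_pos.2 h2
    rw [dotList, List.length_cons] at hl
    push_cast at hl
    have h4 := ih h' (by omega)
    have h5 : a * a = 1 := by omega
    rw [List.length_cons, signVectors, List.mem_append]
    rcases mul_self_eq_one_iff.1 h5 with rfl | rfl
    · exact Or.inl (List.mem_map_of_mem h4)
    · exact Or.inr (List.mem_map_of_mem h4)

theorem eq_of_even_of_mul_self_le {a : ℤ} (h : Even a) (ha : a * a ≤ 8) : a = 0 ∨ a = 2 ∨ a = -2 := by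
  have h1 : a ≤ 2 := by nlinarith
  have h2 : -2 ≤ a := by nlinarith
  obtain ⟨b, rfl⟩ := h
  omega

theorem mem_doubledUnits {l : List ℤ} (h : ∀ a ∈ l, Even a) (hl : dotList l l = 4) :
    l ∈ doubledUnits l.length := by
  induction l with
  | nil => simp [dotList] at hl
  | cons a l ih =>
    have h' : ∀ b ∈ l, Even b := fun b hb => h b (List.mem_cons_of_mem _ hb)
    have h1 := dotList_self_nonneg l
    rw [dotList] at hl
    rw [List.length_cons, doubledUnits, List.mem_append]
    rcases eq_of_even_of_mul_self_le (h a List.mem_cons_self) (by omega) with rfl | rfl | rfl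
    · exact Or.inr (List.mem_map_of_mem (ih h' (by omega)))
    · rw [← eq_replicate_of_dotList_self_eq_zero (l := l) (by omega)]
      simp
    · rw [← eq_replicate_of_dotList_self_eq_zero (l := l) (by omega)]
      simp

theorem mem_doubledRootsD {l : List ℤ} (h : ∀ a ∈ l, Even a) (hl : dotList l l = 8) :
    l ∈ doubledRootsD l.length := by
  induction l with
  | nil => simp [dotList] at hl
  | cons a l ih =>
    have h' : ∀ b ∈ l, Even b := fun b hb => h b (List.mem_cons_of_mem _ hb)
    have h1 := dotList_self_nonneg l
    rw [dotList] at hl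
    rw [List.length_cons, doubledRootsD, List.mem_append, List.mem_append]
    rcases eq_of_even_of_mul_self_le (h a List.mem_cons_self) (by omega) with rfl | rfl | rfl
    · exact Or.inr (List.mem_map_of_mem (ih h' (by omega)))
    · exact Or.inl (Or.inl (List.mem_map_of_mem (mem_doubledUnits h' (by omega))))
    · exact Or.inl (Or.inr (List.mem_map_of_mem (mem_doubledUnits h' (by omega))))

theorem card_sigma_mem_list {α : Type*} {f : α → Type*} [∀ a, Finite (f a)] {l : List α}
    (hl : l.Nodup) :
    Nat.card (Σ a : {a // a ∈ l}, f a.1) = (l.map fun a => Nat.card (f a)).sum := by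
  classical
  rw [Nat.card_sigma, ← List.sum_toFinset _ hl,
    ← Finset.sum_coe_sort l.toFinset fun a => Nat.card (f a)]
  exact Fintype.sum_equiv (Equiv.subtypeEquivRight fun a => by simp) _ _ fun a => rfl

theorem card_mem_list {α : Type*} {l : List α} (hl : l.Nodup) : Nat.card {a // a ∈ l} = l.length := by
  have h := card_sigma_mem_list (f := fun _ : α => Unit) hl
  rw [Nat.card_congr (Equiv.sigmaPUnit _)] at h
  simpa using h

/-! ### Root lattices of type `E` -/

/-- The rows are twice the simple roots of type `E₈`. -/
def simpleRootsE : Matrix (Fin 8) (Fin 8) ℤ :=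
  !![ 1, -1, -1, -1, -1, -1, -1, 1;
      2,  2,  0,  0,  0,  0,  0, 0;
     -2,  2,  0,  0,  0,  0,  0, 0;
      0, -2,  2,  0,  0,  0,  0, 0;
      0,  0, -2,  2,  0,  0,  0, 0;
      0,  0,  0, -2,  2,  0,  0, 0;
      0,  0,  0,  0, -2,  2,  0, 0;
      0,  0,  0,  0,  0, -2,  2, 0]

/-- The columns are twice the fundamental weights of type `E₈`. -/
def fundamentalWeightsE : Matrix (Fin 8) (Fin 8) ℤ :=
  !![0, 1, -1, 0, 0, 0, 0, 0;
     0, 1,  1, 0, 0, 0, 0, 0;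
     0, 1,  1, 2, 0, 0, 0, 0;
     0, 1,  1, 2, 2, 0, 0, 0;
     0, 1,  1, 2, 2, 2, 0, 0;
     0, 1,  1, 2, 2, 2, 2, 0;
     0, 1,  1, 2, 2, 2, 2, 2;
     4, 5,  7, 10, 8, 6, 4, 2]

theorem simpleRootsE_mul_fundamentalWeightsE :
    simpleRootsE * fundamentalWeightsE = (4 : ℤ) • 1 := by
  decide +kernel

theorem simpleRootsE_mul_transpose :
    simpleRootsE * simpleRootsEᵀ = (4 : ℤ) • CartanMatrix.E₈ := by
  decide +kernel

theorem fundamentalWeightsE_mul_simpleRootsE :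
    fundamentalWeightsE * simpleRootsE = (4 : ℤ) • 1 :=
  Matrix.mul_comm_of_mul_eq_smul_one four_ne_zero simpleRootsE_mul_fundamentalWeightsE

/-- The lattice that is spanned by the rows of `simpleRootsE`. -/
theorem exists_vecMul_simpleRootsE_iff (x : Fin 8 → ℤ) :
    (∃ v, v ᵥ* simpleRootsE = x) ↔ (∀ i, Even (x i - x 0)) ∧ 4 ∣ ∑ i, x i := by
  constructor
  · rintro ⟨v, rfl⟩
    refine ⟨fun i => ?_, ?_⟩
    · rw [even_iff_two_dvd]
      fin_cases i <;> simp [Matrix.vecMul, dotProduct, Fin.sum_univ_succ, simpleRootsE] <;> omega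
    · simp [Matrix.vecMul, dotProduct, Fin.sum_univ_succ, simpleRootsE]
      omega
  · rintro ⟨h1, h2⟩
    have h3 : ∀ j, 4 ∣ (x ᵥ* fundamentalWeightsE) j := by
      have e1 := (h1 1).two_dvd
      have e2 := (h1 2).two_dvd
      have e3 := (h1 3).two_dvd
      have e4 := (h1 4).two_dvd
      have e5 := (h1 5).two_dvd
      have e6 := (h1 6).two_dvd
      have e7 := (h1 7).two_dvd
      simp [Fin.sum_univ_succ] at h2
      intro j
      fin_cases j <;>
        simp [Matrix.vecMul, dotProduct, Fin.sum_univ_succ, fundamentalWeightsE] <;> omega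
    choose v hv using h3
    refine ⟨v, ?_⟩
    have h4 : (4 : ℤ) • v = x ᵥ* fundamentalWeightsE := by
      ext j
      rw [hv]
      rfl
    have h5 : (4 : ℤ) • (v ᵥ* simpleRootsE) = (4 : ℤ) • x := by
      rw [← Matrix.smul_vecMul, h4, Matrix.vecMul_vecMul, fundamentalWeightsE_mul_simpleRootsE,
        Matrix.vecMul_smul, Matrix.vecMul_one]
    exact smul_right_injective _ four_ne_zero h5

/-- Twice the vectors of norm `2` in the lattice `E₈`. -/
def rootsE8 : List (List ℤ) :=
  doubledRootsD 8 ++ (signVectors 8).filter fun l => l.sum % 4 = 0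

/-- Twice the vectors of norm `2` in the sublattice that is spanned by the first `k` simple roots,
where `6 ≤ k ≤ 8`. -/
def rootsE (k : ℕ) : List (List ℤ) :=
  rootsE8.filter fun l => (k ≤ 6 → dotList l [0, 0, 0, 0, 0, 2, 2, 4] = 0) ∧
    (k ≤ 7 → dotList l [0, 0, 0, 0, 0, 0, 2, 2] = 0)

theorem mem_rootsE8_spec :
    ∀ l ∈ rootsE8, l.length = 8 ∧ (∀ a ∈ l, Even (a - l.headI)) ∧ l.sum % 4 = 0 := by
  decide +kernel

theorem rootsE8_nodup : rootsE8.Nodup := by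
  decide +kernel

/-- In doubled coordinates the roots have norm 8 and coordinates of equal parity. The even ones have
two entries `±2`, the odd ones are sign vectors with coordinate sum divisible by 4. -/
theorem ofFn_mem_rootsE8_iff {x : Fin 8 → ℤ} (hx : x ⬝ᵥ x = 8) :
    List.ofFn x ∈ rootsE8 ↔ ∃ v, v ᵥ* simpleRootsE = x := by
  rw [exists_vecMul_simpleRootsE_iff]
  constructor
  · intro h
    obtain ⟨-, h1, h2⟩ := mem_rootsE8_spec _ h
    refine ⟨fun i => ?_, ?_⟩
    · have := h1 (x i) (List.mem_ofFn.2 ⟨i, rfl⟩)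
      simpa [List.ofFn_succ] using this
    · rw [List.sum_ofFn] at h2
      omega
  · rintro ⟨h1, h2⟩
    have hlen : (List.ofFn x).length = 8 := List.length_ofFn
    have hdot : dotList (List.ofFn x) (List.ofFn x) = 8 := (dotList_ofFn x x).trans hx
    rw [rootsE8, List.mem_append]
    rcases Int.even_or_odd (x 0) with h0 | h0
    · left
      have h3 : ∀ a ∈ List.ofFn x, Even a := by
        intro a ha
        obtain ⟨i, rfl⟩ := List.mem_ofFn.1 ha
        exact (Int.even_sub.1 (h1 i)).2 h0
      have := mem_doubledRootsD h3 hdot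
      rwa [hlen] at this
    · right
      have h3 : ∀ a ∈ List.ofFn x, Odd a := by
        intro a ha
        obtain ⟨i, rfl⟩ := List.mem_ofFn.1 ha
        rw [← Int.not_even_iff_odd] at h0 ⊢
        exact fun h => h0 ((Int.even_sub.1 (h1 i)).1 h)
      have := mem_signVectors h3 (by rw [hdot, hlen]; rfl)
      rw [hlen] at this
      rw [List.mem_filter]
      refine ⟨this, ?_⟩
      rw [List.sum_ofFn]
      simpa using Int.emod_eq_zero_of_dvd h2

/-- Twice the first `k` simple roots of type `E₈`. -/
def simpleRootsEk {k : ℕ} (hk : k ≤ 8) : Matrix (Fin k) (Fin 8) ℤ :=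
  simpleRootsE.submatrix (Fin.castLE hk) id

theorem vecMul_simpleRootsEk {k : ℕ} (hk : k ≤ 8) (v : Fin 8 → ℤ) (hv : ∀ j, k ≤ j.1 → v j = 0) :
    (fun i => v (Fin.castLE hk i)) ᵥ* simpleRootsEk hk = v ᵥ* simpleRootsE := by
  ext a
  simp only [Matrix.vecMul, dotProduct, simpleRootsEk, Matrix.submatrix_apply, id]
  refine Fintype.sum_of_injective (Fin.castLE hk) (Fin.castLE_injective hk) _ _ (fun j hj => ?_)
    fun i => rfl
  have : v j = 0 := hv j (by
    by_contra h
    exact hj ⟨⟨j, by omega⟩, rfl⟩)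
  rw [this, zero_mul]

/-- Pairing with the fundamental weights returns 4 times the coefficients in the simple roots, so
the sublattice is cut out by the vanishing of the later coefficients. -/
theorem exists_vecMul_simpleRootsEk_iff {k : ℕ} (hk : k ≤ 8) (x : Fin 8 → ℤ) :
    (∃ v, v ᵥ* simpleRootsEk hk = x) ↔
      (∃ v, v ᵥ* simpleRootsE = x) ∧ ∀ j : Fin 8, k ≤ j.1 → (x ᵥ* fundamentalWeightsE) j = 0 := by
  have hcomp : ∀ v : Fin 8 → ℤ, (v ᵥ* simpleRootsE) ᵥ* fundamentalWeightsE = (4 : ℤ) • v := fun v => by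
    rw [Matrix.vecMul_vecMul, simpleRootsE_mul_fundamentalWeightsE, Matrix.vecMul_smul,
      Matrix.vecMul_one]
  constructor
  · rintro ⟨v, rfl⟩
    let w : Fin 8 → ℤ := fun j => if h : j.1 < k then v ⟨j, h⟩ else 0
    have hw : ∀ j, k ≤ j.1 → w j = 0 := fun j hj => dif_neg (by omega)
    have h1 := vecMul_simpleRootsEk hk w hw
    have h2 : (fun i => w (Fin.castLE hk i)) = v := by
      ext i
      simp [w]
    rw [h2] at h1
    refine ⟨⟨w, h1.symm⟩, fun j hj => ?_⟩
    rw [h1, hcomp, Pi.smul_apply, hw j hj, smul_zero]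
  · rintro ⟨⟨v, rfl⟩, h⟩
    refine ⟨_, vecMul_simpleRootsEk hk v fun j hj => ?_⟩
    have := h j hj
    rw [hcomp, Pi.smul_apply, smul_eq_mul] at this
    omega

theorem vecMul_simpleRootsEk_injective {k : ℕ} (hk : k ≤ 8) (v : Fin k → ℤ)
    (hv : v ᵥ* simpleRootsEk hk = 0) : v = 0 := by
  let w : Fin 8 → ℤ := fun j => if h : j.1 < k then v ⟨j, h⟩ else 0
  have h1 := vecMul_simpleRootsEk hk w fun j hj => dif_neg (by omega)
  have h2 : (fun i => w (Fin.castLE hk i)) = v := by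
    ext i
    simp [w]
  rw [h2, hv] at h1
  have h3 : (4 : ℤ) • w = 0 := by
    rw [← Matrix.vecMul_one w, ← Matrix.vecMul_smul, ← simpleRootsE_mul_fundamentalWeightsE,
      ← Matrix.vecMul_vecMul, ← h1, Matrix.zero_vecMul]
  have h4 := (smul_eq_zero.1 h3).resolve_left four_ne_zero
  rw [← h2, h4]
  rfl

theorem ofFn_mem_rootsE_iff {k : ℕ} (hk : k ≤ 8) (hk6 : 6 ≤ k) {x : Fin 8 → ℤ} (hx : x ⬝ᵥ x = 8) :
    List.ofFn x ∈ rootsE k ↔ ∃ v, v ᵥ* simpleRootsEk hk = x := by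
  rw [exists_vecMul_simpleRootsEk_iff, ← ofFn_mem_rootsE8_iff hx, rootsE, List.mem_filter]
  refine and_congr_right fun _ => ?_
  -- The two lists in `rootsE` are the columns 6 and 7 of `fundamentalWeightsE`.
  have h6 : dotList (List.ofFn x) [0, 0, 0, 0, 0, 2, 2, 4] = (x ᵥ* fundamentalWeightsE) 6 :=
    dotList_ofFn x fun i => fundamentalWeightsE i 6
  have h7 : dotList (List.ofFn x) [0, 0, 0, 0, 0, 0, 2, 2] = (x ᵥ* fundamentalWeightsE) 7 :=
    dotList_ofFn x fun i => fundamentalWeightsE i 7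
  rw [h6, h7, decide_eq_true_iff]
  constructor
  · rintro ⟨e6, e7⟩ j hj
    have : j.1 = 6 ∨ j.1 = 7 := by omega
    rcases this with h | h
    · rw [show j = 6 from Fin.ext h]; exact e6 (by omega)
    · rw [show j = 7 from Fin.ext h]; exact e7 (by omega)
  · intro h
    exact ⟨fun h6 => h 6 h6, fun h7 => h 7 h7⟩

/-- The Cartan matrix of type `E` on the first `k` nodes of the diagram `E₈`. -/
def cartanEk {k : ℕ} (hk : k ≤ 8) : Matrix (Fin k) (Fin k) ℤ :=
  CartanMatrix.E₈.submatrix (Fin.castLE hk) (Fin.castLE hk)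

theorem cartanEk_six : cartanEk (k := 6) (by norm_num) = CartanMatrix.E₆ := by
  decide +kernel

theorem cartanEk_seven : cartanEk (k := 7) (by norm_num) = CartanMatrix.E₇ := by
  decide +kernel

theorem simpleRootsEk_mul_transpose {k : ℕ} (hk : k ≤ 8) :
    simpleRootsEk hk * (simpleRootsEk hk)ᵀ = (4 : ℤ) • cartanEk hk := by
  ext i j
  exact congrFun (congrFun simpleRootsE_mul_transpose (Fin.castLE hk i)) (Fin.castLE hk j)

theorem toBilin'_cartanEk_pos {k : ℕ} (hk : k ≤ 8) (v : Fin k → ℤ) (hv : v ≠ 0) :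
    0 < Matrix.toBilin' (cartanEk hk) v v :=
  toBilin'_pos_of_model four_pos (simpleRootsEk_mul_transpose hk)
    (vecMul_simpleRootsEk_injective hk) v hv

theorem toBilin'_cartanEk_comm {k : ℕ} (hk : k ≤ 8) (v w : Fin k → ℤ) :
    Matrix.toBilin' (cartanEk hk) v w = Matrix.toBilin' (cartanEk hk) w v := by
  have h1 := vecMul_dotProduct_vecMul (simpleRootsEk_mul_transpose hk) v w
  have h2 := vecMul_dotProduct_vecMul (simpleRootsEk_mul_transpose hk) w v
  rw [dotProduct_comm, h2] at h1
  omega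

theorem dotList_self_of_mem_rootsE8 : ∀ l ∈ rootsE8, dotList l l = 8 := by
  decide +kernel

theorem exists_ofFn_of_mem_rootsE {k : ℕ} {l : List ℤ} (hl : l ∈ rootsE k) :
    ∃ x : Fin 8 → ℤ, x ⬝ᵥ x = 8 ∧ List.ofFn x = l := by
  have hl' : l ∈ rootsE8 := (List.mem_filter.1 hl).1
  have hlen := (mem_rootsE8_spec l hl').1
  have h : List.ofFn (fun i : Fin 8 => l.get (i.cast hlen.symm)) = l := by
    apply List.ext_get (by simp [hlen])
    intro n h1 h2
    simp only [List.get_eq_getElem, List.getElem_ofFn, Fin.val_cast]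
  refine ⟨_, ?_, h⟩
  rw [← dotList_ofFn, h]
  exact dotList_self_of_mem_rootsE8 l hl'

theorem rootsE_nodup (k : ℕ) : (rootsE k).Nodup := rootsE8_nodup.filter _

theorem exists_root_of_mem_rootsE {k : ℕ} (hk : k ≤ 8) (hk6 : 6 ≤ k) {l : List ℤ}
    (hl : l ∈ rootsE k) : ∃ v, List.ofFn (v ᵥ* simpleRootsEk hk) = l := by
  obtain ⟨x, hx, rfl⟩ := exists_ofFn_of_mem_rootsE hl
  obtain ⟨v, rfl⟩ := (ofFn_mem_rootsE_iff hk hk6 hx).1 hl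
  exact ⟨v, rfl⟩

theorem dotList_vecMul_simpleRootsEk {k : ℕ} (hk : k ≤ 8) (v w : Fin k → ℤ) :
    dotList (List.ofFn (v ᵥ* simpleRootsEk hk)) (List.ofFn (w ᵥ* simpleRootsEk hk)) =
      4 * Matrix.toBilin' (cartanEk hk) v w := by
  rw [dotList_ofFn, vecMul_dotProduct_vecMul (simpleRootsEk_mul_transpose hk)]

theorem ofFn_vecMul_mem_rootsE_iff {k : ℕ} (hk : k ≤ 8) (hk6 : 6 ≤ k) (v : Fin k → ℤ) :
    List.ofFn (v ᵥ* simpleRootsEk hk) ∈ rootsE k ↔ Matrix.toBilin' (cartanEk hk) v v = 2 := by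
  have h := dotList_vecMul_simpleRootsEk hk v v
  constructor
  · intro hv
    have := dotList_self_of_mem_rootsE8 _ (List.mem_filter.1 hv).1
    omega
  · intro hv
    refine (ofFn_mem_rootsE_iff hk hk6 ?_).2 ⟨v, rfl⟩
    rw [← dotList_ofFn]
    omega

theorem ofFn_vecMul_simpleRootsEk_injective {k : ℕ} (hk : k ≤ 8) :
    Function.Injective fun v : Fin k → ℤ => List.ofFn (v ᵥ* simpleRootsEk hk) := by
  intro v w h
  have h1 : v ᵥ* simpleRootsEk hk = w ᵥ* simpleRootsEk hk := List.ofFn_injective h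
  refine sub_eq_zero.1 (vecMul_simpleRootsEk_injective hk _ ?_)
  rw [Matrix.sub_vecMul, h1, sub_self]

theorem rootCount_cartanEk {k : ℕ} (hk : k ≤ 8) (hk6 : 6 ≤ k) :
    rootCount (Matrix.toBilin' (cartanEk hk)) = (rootsE k).length := by
  rw [← card_mem_list (rootsE_nodup k)]
  let F : {v : Fin k → ℤ // Matrix.toBilin' (cartanEk hk) v v = 2} → {l // l ∈ rootsE k} :=
    fun v => ⟨List.ofFn (v.1 ᵥ* simpleRootsEk hk), (ofFn_vecMul_mem_rootsE_iff hk hk6 v.1).2 v.2⟩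
  refine Nat.card_congr (Equiv.ofBijective F ⟨fun v w h => ?_, fun l => ?_⟩)
  · exact Subtype.ext (ofFn_vecMul_simpleRootsEk_injective hk (congrArg Subtype.val h))
  · obtain ⟨v, hv⟩ := exists_root_of_mem_rootsE hk hk6 l.2
    exact ⟨⟨v, (ofFn_vecMul_mem_rootsE_iff hk hk6 v).1 (hv ▸ l.2)⟩, Subtype.ext hv⟩

/-! ### Quadruples of type `D₄` in the root systems of type `E` -/

/-- The vectors in a list of doubled roots that form an angle of 120° with `c`. -/
def neighboursList (R : List (List ℤ)) (c : List ℤ) : List (List ℤ) :=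
  R.filter fun x => dotList x c = -4

/-- The vectors in a list that are orthogonal to `a`. -/
def orthogonalList (R : List (List ℤ)) (a : List ℤ) : List (List ℤ) :=
  R.filter fun x => dotList a x = 0

/-- The number of orthogonal triples in a list of vectors. -/
def orthogonalTriples (N : List (List ℤ)) : ℕ :=
  (N.map fun a => ((orthogonalList N a).map fun b =>
    (orthogonalList (orthogonalList N a) b).length).sum).sum

theorem D_four : CartanMatrix.D 4 = !![2, -1, 0, 0; -1, 2, -1, -1; 0, -1, 2, 0; 0, -1, 0, 2] := by
  decide +kernel

theorem mem_neighboursList_iff {k : ℕ} (hk : k ≤ 8) (hk6 : 6 ≤ k) (v x : Fin k → ℤ) :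
    List.ofFn (v ᵥ* simpleRootsEk hk) ∈
      neighboursList (rootsE k) (List.ofFn (x ᵥ* simpleRootsEk hk)) ↔
      Matrix.toBilin' (cartanEk hk) v v = 2 ∧ Matrix.toBilin' (cartanEk hk) v x = -1 := by
  rw [neighboursList, List.mem_filter, ofFn_vecMul_mem_rootsE_iff hk hk6, decide_eq_true_iff,
    dotList_vecMul_simpleRootsEk]
  omega

theorem mem_orthogonalList_iff {k : ℕ} (hk : k ≤ 8) (R : List (List ℤ)) (v x : Fin k → ℤ) :
    List.ofFn (v ᵥ* simpleRootsEk hk) ∈ orthogonalList R (List.ofFn (x ᵥ* simpleRootsEk hk)) ↔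
      List.ofFn (v ᵥ* simpleRootsEk hk) ∈ R ∧ Matrix.toBilin' (cartanEk hk) x v = 0 := by
  rw [orthogonalList, List.mem_filter, decide_eq_true_iff, dotList_vecMul_simpleRootsEk]
  exact and_congr_right' (by omega)

theorem gramMatrix_eq_D_four_iff {M : Type*} [AddCommGroup M] {β : LinearMap.BilinForm ℤ M}
    (hβ : ∀ x y, β x y = β y x) (g : Fin 4 → M) :
    gramMatrix β g = CartanMatrix.D 4 ↔ β (g 1) (g 1) = 2 ∧
      (β (g 0) (g 0) = 2 ∧ β (g 0) (g 1) = -1) ∧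
      ((β (g 2) (g 2) = 2 ∧ β (g 2) (g 1) = -1) ∧ β (g 0) (g 2) = 0) ∧
      (((β (g 3) (g 3) = 2 ∧ β (g 3) (g 1) = -1) ∧ β (g 0) (g 3) = 0) ∧ β (g 2) (g 3) = 0) := by
  rw [D_four, ← Matrix.ext_iff]
  have h10 := hβ (g 1) (g 0)
  have h20 := hβ (g 2) (g 0)
  have h30 := hβ (g 3) (g 0)
  have h12 := hβ (g 1) (g 2)
  have h13 := hβ (g 1) (g 3)
  have h32 := hβ (g 3) (g 2)
  simp only [Fin.forall_fin_succ, gramMatrix, Matrix.of_apply]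
  simp [h10, h20, h30, h12, h13, h32]
  tauto

/-- Index 1 is the branch node of `D₄`. Once it is fixed, a quadruple is an ordered triple of
pairwise orthogonal roots at 120° to it. -/
theorem card_gramMatrix_eq_D_four {k : ℕ} (hk : k ≤ 8) (hk6 : 6 ≤ k) {x : Fin k → ℤ}
    (hx : Matrix.toBilin' (cartanEk hk) x x = 2) :
    Nat.card {g : Fin 4 → Fin k → ℤ //
      gramMatrix (Matrix.toBilin' (cartanEk hk)) g = CartanMatrix.D 4 ∧ g 1 = x} =
    orthogonalTriples (neighboursList (rootsE k) (List.ofFn (x ᵥ* simpleRootsEk hk))) := by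
  set N := neighboursList (rootsE k) (List.ofFn (x ᵥ* simpleRootsEk hk)) with hN
  have hNd : N.Nodup := (rootsE_nodup k).filter _
  have hNa : ∀ a, (orthogonalList N a).Nodup := fun a => hNd.filter _
  have hfin : ∀ l : List (List ℤ), Finite {c // c ∈ l} := fun l => l.finite_toSet
  have hcard : Nat.card (Σ a : {a // a ∈ N}, Σ b : {b // b ∈ orthogonalList N a.1},
      {c // c ∈ orthogonalList (orthogonalList N a.1) b.1}) = orthogonalTriples N := by
    rw [card_sigma_mem_list (f := fun a => Σ b : {b // b ∈ orthogonalList N a},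
      {c // c ∈ orthogonalList (orthogonalList N a) b.1}) hNd, orthogonalTriples]
    congr 1
    refine List.map_congr_left fun a _ => ?_
    rw [card_sigma_mem_list
      (f := fun b => {c // c ∈ orthogonalList (orthogonalList N a) b}) (hNa a)]
    congr 1
    exact List.map_congr_left fun b _ => card_mem_list ((hNa a).filter _)
  have key : ∀ g : Fin 4 → Fin k → ℤ, g 1 = x →
      (gramMatrix (Matrix.toBilin' (cartanEk hk)) g = CartanMatrix.D 4 ↔
        List.ofFn (g 0 ᵥ* simpleRootsEk hk) ∈ N ∧
        List.ofFn (g 2 ᵥ* simpleRootsEk hk) ∈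
          orthogonalList N (List.ofFn (g 0 ᵥ* simpleRootsEk hk)) ∧
        List.ofFn (g 3 ᵥ* simpleRootsEk hk) ∈
          orthogonalList (orthogonalList N (List.ofFn (g 0 ᵥ* simpleRootsEk hk)))
            (List.ofFn (g 2 ᵥ* simpleRootsEk hk))) := by
    rintro g rfl
    rw [gramMatrix_eq_D_four_iff (toBilin'_cartanEk_comm hk), mem_orthogonalList_iff,
      mem_orthogonalList_iff, mem_orthogonalList_iff, hN, mem_neighboursList_iff hk hk6,
      mem_neighboursList_iff hk hk6, mem_neighboursList_iff hk hk6, and_iff_right hx]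
  rw [← hcard]
  let F : {g : Fin 4 → Fin k → ℤ //
      gramMatrix (Matrix.toBilin' (cartanEk hk)) g = CartanMatrix.D 4 ∧ g 1 = x} →
      Σ a : {a // a ∈ N}, Σ b : {b // b ∈ orthogonalList N a.1},
        {c // c ∈ orthogonalList (orthogonalList N a.1) b.1} := fun g =>
    have h := (key g.1 g.2.2).1 g.2.1
    ⟨⟨_, h.1⟩, ⟨_, h.2.1⟩, ⟨_, h.2.2⟩⟩
  refine Nat.card_congr (Equiv.ofBijective F ⟨fun g g' h => ?_, ?_⟩)
  · have hinj := ofFn_vecMul_simpleRootsEk_injective hk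
    have e0 : g.1 0 = g'.1 0 := hinj (congrArg (fun p => p.1.1) h)
    have e2 : g.1 2 = g'.1 2 := hinj (congrArg (fun p => p.2.1.1) h)
    have e3 : g.1 3 = g'.1 3 := hinj (congrArg (fun p => p.2.2.1) h)
    refine Subtype.ext (funext fun i => ?_)
    fin_cases i
    · exact e0
    · exact g.2.2.trans g'.2.2.symm
    · exact e2
    · exact e3
  · rintro ⟨⟨a, ha⟩, ⟨b, hb⟩, ⟨c, hc⟩⟩
    have hmem : ∀ l ∈ N, ∃ v, List.ofFn (v ᵥ* simpleRootsEk hk) = l := fun l hl =>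
      exists_root_of_mem_rootsE hk hk6 (List.mem_filter.1 hl).1
    obtain ⟨u, rfl⟩ := hmem a ha
    obtain ⟨v, rfl⟩ := hmem b (List.mem_filter.1 hb).1
    obtain ⟨w, rfl⟩ := hmem c (List.mem_filter.1 (List.mem_filter.1 hc).1).1
    exact ⟨⟨![u, x, v, w], (key ![u, x, v, w] rfl).2 ⟨ha, hb, hc⟩, rfl⟩, rfl⟩

/-- Every vector in a list of doubled roots is connected to `c` by a path of three steps of 60°. -/
def IsLinked (R : List (List ℤ)) (c : List ℤ) : Prop :=
  ∀ l ∈ R, ∃ l₁ ∈ R, dotList l l₁ = 4 ∧ ∃ l₂ ∈ R, dotList l₁ l₂ = 4 ∧ dotList l₂ c = 4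

instance (R : List (List ℤ)) (c : List ℤ) : Decidable (IsLinked R c) := by
  unfold IsLinked
  infer_instance

/-- The linking condition is a finite check that every root reaches `c` by three reflections. By
transitivity the enumeration is needed around one centre only. -/
theorem gramCount_cartanEk_D_four {k : ℕ} (hk : k ≤ 8) (hk6 : 6 ≤ k) {c : List ℤ}
    (hc : c ∈ rootsE k) (hlink : IsLinked (rootsE k) c) :
    gramCount (Matrix.toBilin' (cartanEk hk)) (CartanMatrix.D 4) =
      (rootsE k).length * orthogonalTriples (neighboursList (rootsE k) c) := by
  obtain ⟨x₀, rfl⟩ := exists_root_of_mem_rootsE hk hk6 hc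
  have hx₀ := (ofFn_vecMul_mem_rootsE_iff hk hk6 x₀).1 hc
  rw [gramCount_eq_rootCount_mul (toBilin'_cartanEk_comm hk) (a := 1)
    (by rw [D_four]; rfl) hx₀, rootCount_cartanEk hk hk6, card_gramMatrix_eq_D_four hk hk6 hx₀]
  intro x hx
  obtain ⟨l₁, h₁, e₁, l₂, h₂, e₂, e₃⟩ := hlink _ ((ofFn_vecMul_mem_rootsE_iff hk hk6 x).2 hx)
  obtain ⟨y, rfl⟩ := exists_root_of_mem_rootsE hk hk6 h₁
  obtain ⟨z, rfl⟩ := exists_root_of_mem_rootsE hk hk6 h₂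
  rw [dotList_vecMul_simpleRootsEk] at e₁ e₂ e₃
  exact ⟨y, z, (ofFn_vecMul_mem_rootsE_iff hk hk6 y).1 h₁,
    (ofFn_vecMul_mem_rootsE_iff hk hk6 z).1 h₂, by omega, by omega, by omega⟩

/-- The form `D_k` is positive definite, so vectors with this Gram matrix are linearly independent
and cannot exceed the rank. -/
theorem gramCount_D_eq_zero {r k : ℕ} (hk : 3 ≤ k) (hrk : r < k)
    (C : Matrix (Fin r) (Fin r) ℤ) : gramCount (Matrix.toBilin' C) (CartanMatrix.D k) = 0 := by
  rw [gramCount, Nat.card_eq_zero]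
  left
  constructor
  rintro ⟨g, hg⟩
  have hli : LinearIndependent ℤ g := by
    rw [Fintype.linearIndependent_iff]
    intro c hc
    have h1 : (Matrix.toBilin' (CartanMatrix.D k)) c c = 0 := by
      rw [Matrix.toBilin'_apply']
      have : Matrix.toBilin' C (∑ i, c i • g i) (∑ i, c i • g i) = c ⬝ᵥ CartanMatrix.D k *ᵥ c := by
        simp only [map_sum, LinearMap.sum_apply, map_smul, LinearMap.smul_apply, smul_eq_mul,
          dotProduct, mulVec, ← hg, gramMatrix, Matrix.of_apply, Finset.mul_sum]
        rw [Finset.sum_comm]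
        exact Finset.sum_congr rfl fun i _ => Finset.sum_congr rfl fun j _ => by ring
      rw [← this, hc]
      simp
    by_contra hne
    push Not at hne
    obtain ⟨i, hi⟩ := hne
    exact (rootForm_D_pos hk c fun h => hi (congrFun h i)).ne' h1
  have := hli.fintype_card_le_finrank
  simp at this
  omega

/-! ### Finite computations in `E₆`, `E₇` and `E₈` -/

theorem rootsE_length : (rootsE 6).length = 72 ∧ (rootsE 7).length = 126 ∧ (rootsE 8).length = 240 := by
  decide +kernel

theorem mem_rootsE : [0, -2, 2, 0, 0, 0, 0, 0] ∈ rootsE 6 ∧ [0, -2, 2, 0, 0, 0, 0, 0] ∈ rootsE 7 ∧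
    [0, -2, 2, 0, 0, 0, 0, 0] ∈ rootsE 8 := by
  decide +kernel

theorem isLinked_rootsE_six : IsLinked (rootsE 6) [0, -2, 2, 0, 0, 0, 0, 0] := by
  decide +kernel

theorem isLinked_rootsE_seven : IsLinked (rootsE 7) [0, -2, 2, 0, 0, 0, 0, 0] := by
  decide +kernel

theorem isLinked_rootsE_eight : IsLinked (rootsE 8) [0, -2, 2, 0, 0, 0, 0, 0] := by
  decide +kernel

theorem orthogonalTriples_rootsE_six :
    orthogonalTriples (neighboursList (rootsE 6) [0, -2, 2, 0, 0, 0, 0, 0]) = 720 := by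
  decide +kernel

theorem orthogonalTriples_rootsE_seven :
    orthogonalTriples (neighboursList (rootsE 7) [0, -2, 2, 0, 0, 0, 0, 0]) = 2880 := by
  decide +kernel

theorem orthogonalTriples_rootsE_eight :
    orthogonalTriples (neighboursList (rootsE 8) [0, -2, 2, 0, 0, 0, 0, 0]) = 15120 := by
  decide +kernel

theorem rootForm_E6 : rootForm .E6 = Matrix.toBilin' (cartanEk (k := 6) (by norm_num)) :=
  congrArg Matrix.toBilin' cartanEk_six.symm

theorem rootForm_E7 : rootForm .E7 = Matrix.toBilin' (cartanEk (k := 7) (by norm_num)) :=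
  congrArg Matrix.toBilin' cartanEk_seven.symm

theorem rootForm_E8 : rootForm .E8 = Matrix.toBilin' (cartanEk (k := 8) le_rfl) := rfl

/-! ### Root, `D₄` and `D₁₂` counts for Dynkin diagrams and their orthogonal sums -/

/-- The diagrams of type `A`, of type `D` with at least three nodes, and of type `E`. -/
def Dynkin.IsRegular : Dynkin → Prop
  | D n => 3 ≤ n
  | _ => True

instance : DecidablePred Dynkin.IsRegular := fun d => by
  cases d <;> unfold Dynkin.IsRegular <;> infer_instance

/-- The number of roots. -/
def Dynkin.roots : Dynkin → ℕ
  | A n => (n + 1) * n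
  | D n => 2 * (n * (n - 1))
  | E6 => 72
  | E7 => 126
  | E8 => 240

/-- The number of quadruples of roots with the Gram matrix of `D₄`. -/
def Dynkin.quadruples : Dynkin → ℕ
  | A _ => 0
  | D n => 3 * (2 ^ 4 * n.descFactorial 4)
  | E6 => 72 * 720
  | E7 => 126 * 2880
  | E8 => 240 * 15120

/-- The number of families of roots with the Gram matrix of `D₁₂`. -/
def Dynkin.dodecuples : Dynkin → ℕ
  | D n => 2 ^ 12 * n.descFactorial 12
  | _ => 0

theorem rootForm_pos {d : Dynkin} (hd : d.IsRegular) (v : Fin d.rank → ℤ) (hv : v ≠ 0) :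
    0 < rootForm d v v := by
  cases d with
  | A n => exact rootForm_A_pos n v hv
  | D n => exact rootForm_D_pos hd v hv
  | E6 => rw [rootForm_E6]; exact toBilin'_cartanEk_pos _ v hv
  | E7 => rw [rootForm_E7]; exact toBilin'_cartanEk_pos _ v hv
  | E8 => rw [rootForm_E8]; exact toBilin'_cartanEk_pos _ v hv

theorem rootCount_rootForm {d : Dynkin} (hd : d.IsRegular) : rootCount (rootForm d) = d.roots := by
  cases d with
  | A n => exact rootCount_rootForm_A n
  | D n => exact rootCount_rootForm_D hd
  | E6 => rw [rootForm_E6]; exact (rootCount_cartanEk _ (by norm_num)).trans rootsE_length.1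
  | E7 => rw [rootForm_E7]; exact (rootCount_cartanEk _ (by norm_num)).trans rootsE_length.2.1
  | E8 => rw [rootForm_E8]; exact (rootCount_cartanEk _ (by norm_num)).trans rootsE_length.2.2

theorem gramCount_rootForm_D_four {d : Dynkin} (hd : d.IsRegular) :
    gramCount (rootForm d) (CartanMatrix.D 4) = d.quadruples := by
  cases d with
  | A n => exact gramCount_rootForm_A_eq_zero n (fun i => by simp) (containsD4_D le_rfl)
  | D n => exact gramCount_rootForm_D_D4 hd
  | E6 =>
    rw [rootForm_E6]
    refine (gramCount_cartanEk_D_four _ (by norm_num) mem_rootsE.1 isLinked_rootsE_six).trans ?_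
    rw [rootsE_length.1, orthogonalTriples_rootsE_six]
    rfl
  | E7 =>
    rw [rootForm_E7]
    refine (gramCount_cartanEk_D_four _ (by norm_num) mem_rootsE.2.1 isLinked_rootsE_seven).trans ?_
    rw [rootsE_length.2.1, orthogonalTriples_rootsE_seven]
    rfl
  | E8 =>
    rw [rootForm_E8]
    refine (gramCount_cartanEk_D_four _ (by norm_num) mem_rootsE.2.2 isLinked_rootsE_eight).trans ?_
    rw [rootsE_length.2.2, orthogonalTriples_rootsE_eight]
    rfl

theorem gramCount_rootForm_D_twelve {d : Dynkin} (hd : d.IsRegular) :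
    gramCount (rootForm d) (CartanMatrix.D 12) = d.dodecuples := by
  cases d with
  | A n => exact gramCount_rootForm_A_eq_zero n (fun i => by simp) (containsD4_D (by norm_num))
  | D n => exact gramCount_rootForm_D_D hd (by norm_num)
  | E6 => exact gramCount_D_eq_zero (by norm_num) (by decide) _
  | E7 => exact gramCount_D_eq_zero (by norm_num) (by decide) _
  | E8 => exact gramCount_D_eq_zero (by norm_num) (by decide) _

section RootLattice

variable {L : Type*} [AddCommGroup L] {B : LinearMap.BilinForm ℤ L} {R : List Dynkin}

theorem HasRootLattice.rootCount_eq_sum (h : IsEvenUnimodular B) (hR : HasRootLattice B R)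
    (hreg : ∀ d ∈ R, d.IsRegular) : rootCount B = (R.map Dynkin.roots).sum := by
  rw [HasRootLattice.rootCount_eq h hR fun d hd => rootForm_pos (hreg d hd)]
  exact congrArg _ (List.map_congr_left fun d hd => rootCount_rootForm (hreg d hd))

theorem HasRootLattice.gramCount_D_four_eq_sum (h : IsEvenUnimodular B) (hR : HasRootLattice B R)
    (hreg : ∀ d ∈ R, d.IsRegular) :
    gramCount B (CartanMatrix.D 4) = (R.map Dynkin.quadruples).sum := by
  rw [HasRootLattice.gramCount_eq h hR (fun d hd => rootForm_pos (hreg d hd)) (by norm_num)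
    (fun i => by simp) (isConnectedGram_D (by norm_num))]
  exact congrArg _ (List.map_congr_left fun d hd => gramCount_rootForm_D_four (hreg d hd))

theorem HasRootLattice.gramCount_D_twelve_eq_sum (h : IsEvenUnimodular B) (hR : HasRootLattice B R)
    (hreg : ∀ d ∈ R, d.IsRegular) :
    gramCount B (CartanMatrix.D 12) = (R.map Dynkin.dodecuples).sum := by
  rw [HasRootLattice.gramCount_eq h hR (fun d hd => rootForm_pos (hreg d hd)) (by norm_num)
    (fun i => by simp) (isConnectedGram_D (by norm_num))]
  exact congrArg _ (List.map_congr_left fun d hd => gramCount_rootForm_D_twelve (hreg d hd))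

end RootLattice

/-! ### The linear relation between the theta series -/

/-- The numbers of roots of the Niemeier lattices. -/
def niemeierRootCount : Fin 24 → ℕ :=
  ![0, 48, 72, 96, 120, 144, 144, 168, 192, 216, 240, 240, 288, 288, 312, 336, 384, 432,
    432, 528, 600, 720, 720, 1104]

/-- The numbers of quadruples with the Gram matrix of `D₄` in the Niemeier lattices. -/
def niemeierQuadruples : Fin 24 → ℕ :=
  ![0, 0, 0, 0, 0, 1152, 6912, 0, 11520, 0, 17280, 69120, 92160, 207360, 0, 241920, 145152,
    967680, 362880, 1140480, 0, 5725440, 10886400, 12241152]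

theorem niemeierRoots_regular : ∀ i, ∀ d ∈ niemeierRoots i, d.IsRegular := by
  decide +kernel

theorem sum_roots_niemeierRoots :
    ∀ i, ((niemeierRoots i).map Dynkin.roots).sum = niemeierRootCount i := by
  decide +kernel

theorem sum_quadruples_niemeierRoots :
    ∀ i, ((niemeierRoots i).map Dynkin.quadruples).sum = niemeierQuadruples i := by
  decide +kernel

/-- Only the root lattices `D₁₂²`, `D₁₆E₈` and `D₂₄` contribute, since the falling factorial
vanishes for `n < 12`. This fixes the normalisation of the coefficients. -/
theorem sum_niemeierCoeff_mul_dodecuples :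
    ∑ i, niemeierCoeff i * (((niemeierRoots i).map Dynkin.dodecuples).sum : ℚ) = 1 := by
  decide +kernel

/-- The exponents `(a, b)` with `b ≤ 2` and `a + 4 b ≤ 11`. -/
def monomialExponents (j : Fin 24) : ℕ × ℕ :=
  if j.1 < 12 then (j, 0) else if j.1 < 20 then (j - 12, 1) else (j - 20, 2)

theorem monomialExponents_le :
    ∀ j, (monomialExponents j).1 + (monomialExponents j).2 * 4 ≤ 11 := by
  decide

/-- The value of a monomial in the number of roots and the number of quadruples. -/
def niemeierMonomial (i j : Fin 24) : ℕ :=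
  niemeierRootCount i ^ (monomialExponents j).1 * niemeierQuadruples i ^ (monomialExponents j).2

theorem sum_niemeierCoeff_mul_monomial :
    ∀ j, ∑ i, niemeierCoeff i * (niemeierMonomial i j : ℚ) = 0 := by
  decide +kernel

/-- The values of the monomials. The column of the eleventh power of the number of roots is
replaced by a unit vector, since the monomials satisfy one linear relation. -/
def niemeierMatrix : Matrix (Fin 24) (Fin 24) ℤ :=
  Matrix.of fun i j => if j = 11 then (if i = 23 then 1 else 0) else (niemeierMonomial i j : ℤ)

/-- The inverse of `niemeierMatrix` modulo `17`. -/
def niemeierMatrixInverse : Matrix (Fin 24) (Fin 24) ℤ :=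
  !![1, 0, 0, 0, 0, 0, 0, 0, 0, 0, 0, 0, 0, 0, 0, 0, 0, 0, 0, 0, 0, 0, 0, 0;
    -5, 1, -7, 1, 5, 1, -3, 1, 0, 1, 2, 8, -3, 7, 7, 0, 0, -4, 5, 0, -8, 2, 6, 0;
    -4, 5, 3, 6, 0, 6, -4, -4, 3, -6, 3, -2, 4, 4, -3, 1, 6, 2, 7, 8, 8, -8, -1, 0;
    8, 2, 1, 7, 1, 8, 7, 1, 3, 8, 7, -3, -2, 1, -2, 1, 6, -6, 0, 8, 5, -4, -6, 0;
    7, -4, -8, -7, 0, 8, 1, 5, -8, 2, 6, -1, 8, -7, 5, 3, 1, -5, 5, 7, 4, 7, 5, 0;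
    -6, -4, -6, -8, 0, 1, 1, 7, -4, -4, -3, 1, -4, 1, 8, -7, -8, 1, -4, -5, -7, 6, -7, 0;
    -7, -5, 5, -8, 3, -8, 1, 0, 6, -3, 0, 6, 0, 4, 6, 2, -5, -1, -1, -1, -3, -5, -3, 0;
    -1, -4, -8, -1, 1, 1, 0, 3, -3, 4, -6, 7, -8, -6, 6, -1, -6, 4, -6, -8, 1, 5, -8, 0;
    6, -3, 8, 3, -4, -4, -6, 5, 1, -8, 6, 8, 8, -1, 2, 6, 2, 2, -5, -3, -6, 8, -8, 0;
    -4, 8, -8, 2, -2, -5, -2, 4, 0, -1, 7, -6, -2, -1, 5, 0, 0, 3, -8, 0, -1, 7, 4, 0;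
    5, 4, 3, 5, -3, -8, 5, -5, 2, 7, -5, -1, -1, -2, 0, -5, 4, 4, 7, -6, 7, -1, 1, 0;
    -3, -1, -2, -6, 7, -2, -1, 6, 7, 3, -8, -8, 6, 7, -8, 8, -3, -5, -7, -4, -8, 6, -2, 1;
    2, 5, 7, 8, -4, 7, 3, -6, -1, 8, -6, -1, 1, 1, 6, -1, -1, 0, 3, -2, 3, 8, -6, 0;
    6, 4, 7, 0, 2, -2, 1, 2, -6, -7, -4, -6, 3, -3, -3, -1, 3, 7, 6, -2, 3, 0, 7, 0;
    -6, 7, 0, 1, 5, -7, 0, -2, -8, -8, -8, 2, -3, 5, 1, 7, -6, 0, 6, 4, 4, 4, 2, 0;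
    2, 1, 1, 0, 6, 6, 6, -4, 5, 0, 4, -6, 0, -8, -2, 2, -8, -8, 3, -8, -6, 8, 6, 0;
    -6, 3, 7, -1, 6, 5, 1, -5, -6, -2, -7, -5, 6, -1, -8, 5, -7, -1, -3, 8, -1, -7, 2, 0;
    4, -7, 0, -2, 6, -2, -3, 6, 7, 5, -5, -3, 0, -6, 3, 0, -8, 3, 3, 5, 4, -7, -3, 0;
    -2, 6, 5, 4, -4, -1, 7, 5, -8, 3, 8, -3, -2, -1, -4, 4, 2, 6, 7, 0, 2, 3, -3, 0;
    7, 5, -8, 8, -4, 0, 6, -6, -5, 6, 1, 0, 7, -7, 6, 5, -2, -2, -6, -6, -1, -4, 0, 0;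
    7, -2, -1, -6, 6, -8, 1, 3, 6, -5, 7, 0, 6, 7, 5, 2, -5, 4, -3, -1, -3, -8, 5, 0;
    4, 7, 2, 1, -5, 7, -7, -7, 3, -7, 7, -3, 1, -6, 4, 1, 6, -6, 0, 8, 5, -1, 3, 0;
    7, -7, 6, -2, 0, -6, 0, 1, 1, 2, 0, 1, -8, 8, -6, 6, 2, 0, 6, -3, 6, -4, 7, 0;
    -8, -5, 8, 6, 2, 1, 2, -4, -5, 5, 3, 7, 6, -6, -2, 4, 7, -3, -5, -2, 1, 8, -3, 0]

theorem niemeierMatrixInverse_mul_niemeierMatrix :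
    ∀ i j, (niemeierMatrixInverse * niemeierMatrix) i j % 17 = if i = j then 1 else 0 := by
  decide +kernel

/-- An explicit inverse modulo 17 certifies that the determinant is not divisible by 17, without
computing it. -/
theorem det_niemeierMatrix_ne_zero : niemeierMatrix.det ≠ 0 := by
  intro h
  have h1 : (niemeierMatrixInverse * niemeierMatrix).map (Int.castRingHom (ZMod 17)) = 1 := by
    ext i j
    have h2 := niemeierMatrixInverse_mul_niemeierMatrix i j
    rw [Matrix.map_apply, Matrix.one_apply, eq_intCast, ← ZMod.intCast_mod, Nat.cast_ofNat, h2]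
    split_ifs <;> simp
  have h3 := congrArg Matrix.det h1
  rw [← RingHom.mapMatrix_apply, ← RingHom.map_det, Matrix.det_mul, h, mul_zero, map_zero,
    Matrix.det_one] at h3
  exact absurd h3 (by decide)

/-- The explicit coefficients solve the same system. Subtracting a multiple makes the last entry
vanish, and then the invertible matrix, whose column 11 reads off that entry, kills the difference.
-/
theorem exists_smul_niemeierCoeff_of_sum_eq_zero {c : Fin 24 → ℂ}
    (hc : ∀ j, ∑ i, c i * (niemeierMonomial i j : ℂ) = 0) :
    ∃ z : ℂ, ∀ i, c i = z * (niemeierCoeff i : ℂ) := by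
  have h23 : (niemeierCoeff 23 : ℂ) ≠ 0 := by
    rw [Rat.cast_ne_zero]
    decide +kernel
  have hcoeff : ∀ j, ∑ i, (niemeierCoeff i : ℂ) * (niemeierMonomial i j : ℂ) = 0 := fun j => by
    exact_mod_cast congrArg (Rat.cast : ℚ → ℂ) (sum_niemeierCoeff_mul_monomial j)
  -- This choice makes the entry at 23 of the difference zero, which replaces the equation of the
  -- eleventh power.
  set z : ℂ := c 23 / niemeierCoeff 23 with hz
  refine ⟨z, fun i => sub_eq_zero.1 ?_⟩
  set v : Fin 24 → ℂ := fun i => c i - z * niemeierCoeff i with hv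
  suffices h : v = 0 from congrFun h i
  have hdet : (niemeierMatrix.map (Int.castRingHom ℂ)).det ≠ 0 := by
    rw [← RingHom.mapMatrix_apply, ← RingHom.map_det, eq_intCast, Int.cast_ne_zero]
    exact det_niemeierMatrix_ne_zero
  refine Matrix.eq_zero_of_vecMul_eq_zero hdet (funext fun j => ?_)
  simp only [Matrix.vecMul, dotProduct, Matrix.map_apply, Pi.zero_apply, niemeierMatrix,
    Matrix.of_apply]
  by_cases hj : j = 11
  · simp [hj, hv, hz, div_mul_cancel₀ _ h23]
  · simp only [hj, if_false, hv, sub_mul, Finset.sum_sub_distrib, eq_intCast, Int.cast_natCast, hc,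
      mul_assoc, ← Finset.mul_sum, hcoeff, mul_zero, sub_zero]

section Niemeier

variable {L : Fin 24 → Type*} [∀ i, AddCommGroup (L i)] {B : ∀ i, LinearMap.BilinForm ℤ (L i)}

theorem sum_niemeierCoeff_mul_gramCount (hB : ∀ i, IsNiemeierLattice (B i) (niemeierRoots i)) :
    ∑ i, (niemeierCoeff i : ℂ) * (gramCount (B i) (CartanMatrix.D 12) : ℂ) = 1 := by
  rw [← Rat.cast_one, ← sum_niemeierCoeff_mul_dodecuples, Rat.cast_sum]
  refine Finset.sum_congr rfl fun i _ => ?_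
  rw [(hB i).roots.gramCount_D_twelve_eq_sum (hB i).toIsEvenUnimodular (niemeierRoots_regular i),
    Rat.cast_mul, Rat.cast_natCast]

/-- A linear combination of theta series that is annihilated by the Siegel operator is a multiple
of the explicit one. -/
theorem exists_smul_niemeierCoeff_of_tendsto
    (hB : ∀ i, IsNiemeierLattice (B i) (niemeierRoots i)) {c : Fin 24 → ℂ}
    (hc : ∀ Z : SiegelSpace 11,
      Tendsto (fun t => ∑ i, c i * theta 12 (B i) (border Z t)) atTop (𝓝 0)) :
    ∃ z : ℂ, ∀ i, c i = z * (niemeierCoeff i : ℂ) := by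
  have hU : ∀ i, IsEvenUnimodular (B i) := fun i => (hB i).toIsEvenUnimodular
  -- The Siegel operator applied termwise gives the degree 11 combination, and limits are unique.
  have h0 : ∀ Z, ∑ i, c i * theta 11 (B i) Z = 0 := fun Z =>
    tendsto_nhds_unique (tendsto_finsetSum _ fun i _ =>
      ((hU i).tendsto_theta_border Z).const_mul (c i)) (hc Z)
  refine exists_smul_niemeierCoeff_of_sum_eq_zero fun j => ?_
  have h := sum_mul_rootCount_pow_mul_gramCount_pow hU (sum_mul_card_eq_zero hU h0)
    (S := CartanMatrix.D 4) (fun p => by simp) (monomialExponents_le j)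
  rw [← h]
  refine Finset.sum_congr rfl fun i _ => ?_
  rw [(hB i).roots.rootCount_eq_sum (hU i) (niemeierRoots_regular i), sum_roots_niemeierRoots,
    (hB i).roots.gramCount_D_four_eq_sum (hU i) (niemeierRoots_regular i),
    sum_quadruples_niemeierRoots, niemeierMonomial]
  push_cast
  rfl

end Niemeier

theorem theorem4 {L : Fin 24 → Type*} [∀ i, AddCommGroup (L i)]
    (B : ∀ i, LinearMap.BilinForm ℤ (L i))
    (hB : ∀ i, IsNiemeierLattice (B i) (niemeierRoots i)) :
    LinearIndependent ℂ (fun i => theta 12 (B i)) ∧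
    (∀ f ∈ Submodule.span ℂ (Set.range fun i => theta 12 (B i)),
      IsSiegelCuspForm 12 f → ∃ c : ℂ, f = c • niemeierForm B) ∧
    ∃ a : EvenMatrix 12 → ℂ, IsFourierExpansion (niemeierForm B) a ∧ a gramD12 = 1 := by
  have hU : ∀ i, IsEvenUnimodular (B i) := fun i => (hB i).toIsEvenUnimodular
  have hone := sum_niemeierCoeff_mul_gramCount hB
  refine ⟨?_, ?_, ?_⟩
  · rw [Fintype.linearIndependent_iff]
    intro c hc
    have hc' : ∀ Z, ∑ i, c i * theta 12 (B i) Z = 0 := fun Z => by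
      simpa [Finset.sum_apply] using congrFun hc Z
    obtain ⟨z, hz⟩ := exists_smul_niemeierCoeff_of_tendsto hB (c := c) fun Z => by
      simp only [hc', tendsto_const_nhds]
    -- The `D₁₂` coefficient of `z` times the explicit form is `z`, so `z` vanishes.
    have h := sum_mul_card_eq_zero hU hc' (CartanMatrix.D 12)
    simp only [hz, mul_assoc, ← Finset.mul_sum] at h
    rw [show ∑ i, (niemeierCoeff i : ℂ) * (Nat.card {g : Fin 12 → L i //
      gramMatrix (B i) g = CartanMatrix.D 12} : ℂ) = 1 from hone, mul_one] at h
    intro i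
    rw [hz, h, zero_mul]
  · intro f hf hcusp
    obtain ⟨c, rfl⟩ := (Submodule.mem_span_range_iff_exists_fun ℂ).1 hf
    obtain ⟨z, hz⟩ := exists_smul_niemeierCoeff_of_tendsto hB (c := c) fun Z => by
      simpa [Finset.sum_apply] using hcusp.cusp Z
    refine ⟨z, ?_⟩
    simp only [niemeierForm, Finset.smul_sum, smul_smul, hz]
  -- The coefficients are the same combination of representation numbers, so the value at `D₁₂` is
  -- the sum already computed.
  · refine ⟨fun T => ∑ i, (niemeierCoeff i : ℂ) * (gramCount (B i) T.1 : ℂ), fun Z => ?_, hone⟩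
    have h := hasSum_sum fun i (_ : i ∈ Finset.univ) =>
      ((hU i).hasSum_theta Z).mul_left (niemeierCoeff i : ℂ)
    simp only [← mul_assoc, ← Finset.sum_mul] at h
    simpa [niemeierForm, Finset.sum_apply, gramCount] using h
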